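/- **Setting.** Let $d\ge 2$, $\mathcal X_d=\mathbb S^{d-1}\times\mathbb S^{d-1}\subset\mathbb R^{2d}$, and let $f_d:\mathcal X_d\to[-1,1]$ be measurable. Let $\mathscr D_d$ be the law of $(x,f_d(x))$ with $x$ uniform on $\mathcal X_d$, let $\mathscr L(g)=\mathbb E_{(x,y)\sim\mathscr D_d}[(g(x)-y)^2]$, and for an i.i.d. sample $S=((x_i,y_i))_{i=1}^m$ from $\mathscr D_d$ let $\mathscr L_S(g)=\frac1m\sum_{i=1}^m(g(x_i)-y_i)^2$ and $|S|=m$. Let $\mathcal N_L$ be the set of functions on $\mathcal X_d$ realized by depth-$L$ fully connected ReLU networks (with biases, of arbitrary finite widths, with scalar output), and for $g\in\mathcal N_L$ let $R_L(g)=\inf\{\|\phi\|^2/L\}$ over all depth-$L$ parameters $\phi$ with $f_\phi=g$ on $\mathcal X_d$, where $\|\phi\|^2$ is the sum of squares of all weights and biases. *Ideal depth-2 rule.* Let $\mathcal P_2(S)$ be the set of Pareto optimal $g\in\mathcal N_2$ for the bi-criteria problem $\min_{g\in\mathcal N_2}(\mathscr L_S(g),R_2(g))$. The ideal rule $A_2^*(S)$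 returns a minimizer of $\mathscr L$ over $\mathcal P_2(S)$; its loss $\mathscr L(A_2^*(S))$ is read as $\inf_{g\in\mathcal P_2(S)}\mathscr L(g)$ whether or not the infimum is attained. *Depth-3 threshold rule.* For $\alpha\ge1$ and $\theta\ge 0$, the $\alpha$-approximate depth-3 threshold rule returns some $g\in\mathcal N_3$ with $\mathscr L_S(g)\le\alpha\theta$ and $R_3(g)\le\alpha\inf\{R_3(h):h\in\mathcal N_3,\ \mathscr L_S(h)\le\theta\}$; for $\alpha=1$ this is the exact threshold rule. We say that it *reaches error $\varepsilon$ with probability at least $1-\delta$* if, outside a set of samples $S$ of outer probability at most $\delta$, all its possible outputs $g$ satisfy $\mathscr L(g)\le\varepsilon$. **Theorem.** Let $\alpha\ge 1$ and $c>0$ with $\alpha c<1$. There is a constant $C=C(\alpha,c)>0$ such that the following holds for all $d\ge2$ and all $f_d$ as above. Suppose that $m_2:\mathbb R\to\mathbb N$ satisfies $\mathbb E_S[\mathscr L(A_2^*(S))]\le\varepsilon$ for all $\varepsilon>0$ and all sample sizes $|S|\ge m_2(\varepsilon)$. Then for all $\varepsilon,\delta>0$, the $\alpha$-approximate depth-3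 threshold rule with $\theta=c\,\varepsilon$ reaches error $\varepsilon$ with probability at least $1-\delta$ for every sample size $$|S|\ \ge\ C\,\varepsilon^{-2}\Big(d+m_2\big(\tfrac{c\,\varepsilon}{16}\big)^{\frac{d+3}{d-1}}\Big)^6\log\frac2\delta .$$ For $c=\frac14$ this says: for every $1\le\alpha<4$ (in particular for the exact rule, $\alpha=1$, and for $\alpha=2$), the rule with $\theta=\varepsilon/4$ succeeds once $|S|\ge C_\alpha\,\varepsilon^{-2}\big(d+m_2(\varepsilon/64)^{\frac{d+3}{d-1}}\big)^6\log(2/\delta)$. For $c=\frac1{2\alpha}$ it covers every $\alpha\ge1$, with $\theta=\frac{\varepsilon}{2\alpha}$ and $m_2\big(\frac{\varepsilon}{32\alpha}\big)$. In particular, let $(f_d)_{d\ge2}$ be a family of such targets and let $m_2(d,\cdot)$ be as above for $f_d$. 1. If for every $\varepsilon>0$ the function $d\mapsto m_2(d,\varepsilon)$ is bounded by a polynomial $A d^k$, then for every $\varepsilon>0$ there are $A',k'$ (depending also on $\alpha,c$) such that for all $d\ge 2$ and $\delta>0$ the rule with $\theta=c\varepsilon$ reaches error $\varepsilon$ with probability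 at least $1-\delta$ whenever $|S|\ge A'd^{k'}\log(2/\delta)$. 2. If $m_2(d,\varepsilon)\le A(d+1/\varepsilon)^k$ for all $d\ge2$ and $\varepsilon>0$, then there are $A',k'$ such that for all $d\ge 2$ and $\varepsilon,\delta>0$ the rule with $\theta=c\varepsilon$ reaches error $\varepsilon$ with probability at least $1-\delta$ whenever $|S|\ge A'(d+1/\varepsilon)^{k'}\log(2/\delta)$. -/

import Mathlib

open MeasureTheory Set
open scoped ENNReal

namespace DepthSep

noncomputable section

/-! ### The input space and the data distributions -/

/-- The unit sphere of `ℝ^d`. -/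
abbrev Sph (d : ℕ) : Type := Metric.sphere (0 : EuclideanSpace ℝ (Fin d)) 1

/-- The product of two unit spheres of `ℝ^d`. -/
abbrev X (d : ℕ) : Type := Sph d × Sph d

/-- A point of the product of spheres, as a vector with `2d` real entries. -/
def toVec {d : ℕ} (x : X d) : Fin (d + d) → ℝ :=
  Fin.append (fun i => x.1.1 i) (fun i => x.2.1 i)

/-- The uniform probability measure on the sphere: normalized surface measure. -/
def unifSphere (d : ℕ) : Measure (Sph d) :=
  ((volume : Measure (EuclideanSpace ℝ (Fin d))).toSphere univ)⁻¹ •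
    (volume : Measure (EuclideanSpace ℝ (Fin d))).toSphere

/-- The uniform probability measure on the product of the two spheres. -/
def unifX (d : ℕ) : Measure (X d) := (unifSphere d).prod (unifSphere d)

/-- The law of `(x, f x)` where `x` is uniform on the product of the spheres. -/
def dataDist (d : ℕ) (f : X d → ℝ) : Measure (X d × ℝ) :=
  (unifX d).map (fun x => (x, f x))

/-- Target functions: measurable with values in `[-1, 1]`. -/
def IsTarget (d : ℕ) (f : X d → ℝ) : Prop :=
  Measurable f ∧ ∀ x, f x ∈ Icc (-1 : ℝ) 1

/-- A sample of size `m`. -/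
abbrev Sample (d m : ℕ) : Type := Fin m → X d × ℝ

/-- The law of `m` i.i.d. draws of `(x, f x)`. -/
def sampleDist (d : ℕ) (f : X d → ℝ) (m : ℕ) : Measure (Sample d m) :=
  Measure.pi (fun _ : Fin m => dataDist d f)

/-! ### Networks and their representation cost -/

/-- Parameters of a fully connected ReLU network with `n` inputs, scalar output, and arbitrary
hidden widths; the second index is the depth, i.e. the number of affine layers. -/
inductive Net : ℕ → ℕ → Type
  | output {n : ℕ} (w : Fin n → ℝ) (b : ℝ) : Net n 1
  | layer {n k L : ℕ} (W : Matrix (Fin k) (Fin n) ℝ) (b : Fin k → ℝ) (rest : Net k L) :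
      Net n (L + 1)

/-- The function on `ℝ^n` computed by a network. The activation is not applied after the output
layer. -/
def Net.eval : {n L : ℕ} → Net n L → (Fin n → ℝ) → ℝ
  | _, _, .output w b, x => w ⬝ᵥ x + b
  | _, _, .layer W b rest, x => rest.eval (fun i => max ((W.mulVec x) i + b i) 0)

/-- The sum of the squares of all weights and biases. -/
def Net.normSq : {n L : ℕ} → Net n L → ℝ
  | _, _, .output w b => (∑ i, w i ^ 2) + b ^ 2
  | _, _, .layer W b rest => (∑ i, ∑ j, W i j ^ 2) + (∑ i, b i ^ 2) + rest.normSq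

/-- The function on the product of spheres realized by a network with `2d` inputs. -/
def Net.realize {d L : ℕ} (φ : Net (d + d) L) : X d → ℝ := fun x => φ.eval (toVec x)

/-- The functions on the product of spheres realized by depth-`L` networks of unbounded width. -/
def netFun (d L : ℕ) : Set (X d → ℝ) := range (fun φ : Net (d + d) L => φ.realize)

/-- The depth-`L` representation cost `R_L`: the infimum of `‖φ‖² / L` over all depth-`L`
parameters that realize `g` on the product of spheres (`∞` if there are none). -/
def repCost (d L : ℕ) (g : X d → ℝ) : ℝ≥0∞ :=
  ⨅ (φ : Net (d + d) L) (_ : φ.realize = g), ENNReal.ofReal (φ.normSq / L)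

/-! ### Losses -/

/-- The population squared loss. -/
def popLoss {d : ℕ} (D : Measure (X d × ℝ)) (g : X d → ℝ) : ℝ≥0∞ :=
  ∫⁻ p, ENNReal.ofReal ((g p.1 - p.2) ^ 2) ∂D

/-- The empirical squared loss. -/
def sampleLoss {d m : ℕ} (S : Sample d m) (g : X d → ℝ) : ℝ :=
  (1 / (m : ℝ)) * ∑ i, (g (S i).1 - (S i).2) ^ 2

/-! ### Learning rules -/

/-- The Pareto frontier of the bi-criteria problem `min (sampleLoss S g, R_L g)` over depth-`L`
networks `g`: those `g` for which no `h` is at least as good in both criteria and strictly better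
in one of them. -/
def pareto (d L : ℕ) {m : ℕ} (S : Sample d m) : Set (X d → ℝ) :=
  {g | g ∈ netFun d L ∧ ¬ ∃ h ∈ netFun d L,
    sampleLoss S h ≤ sampleLoss S g ∧ repCost d L h ≤ repCost d L g ∧
      (sampleLoss S h < sampleLoss S g ∨ repCost d L h < repCost d L g)}

/-- The population loss of the ideal depth-`L` rule on the sample `S`: this rule picks, among all
Pareto optimal functions, one of least population loss. If the minimum is not attained the least
loss is understood as the infimum; see `idealLoss_eq` for the case where it is attained. -/
def idealLoss (d L : ℕ) (D : Measure (X d × ℝ)) {m : ℕ} (S : Sample d m) : ℝ≥0∞ :=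
  ⨅ g ∈ pareto d L S, popLoss D g

theorem idealLoss_eq {d L m : ℕ} {D : Measure (X d × ℝ)} {S : Sample d m} {g : X d → ℝ}
    (hg : g ∈ pareto d L S) (hmin : ∀ h ∈ pareto d L S, popLoss D g ≤ popLoss D h) :
    idealLoss d L D S = popLoss D g :=
  le_antisymm (iInf₂_le g hg) (le_iInf₂ hmin)

/-- The functions that the `α`-approximate depth-`L` threshold rule with threshold `θ` may return
on the sample `S`. For `α = 1` these are the possible outputs of the exact threshold rule. -/
def thresholdOutputs (d L : ℕ) (α θ : ℝ) {m : ℕ} (S : Sample d m) : Set (X d → ℝ) :=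
  {g | g ∈ netFun d L ∧ sampleLoss S g ≤ α * θ ∧
    repCost d L g ≤ ENNReal.ofReal α *
      ⨅ h ∈ {h : X d → ℝ | h ∈ netFun d L ∧ sampleLoss S h ≤ θ}, repCost d L h}

/-- `m₂` is a sample complexity function of the ideal depth-2 rule for the target `f`: the expected
population loss of that rule is at most `ε` on samples of every size `m ≥ m₂ ε`. -/
def IdealTwoLearns (d : ℕ) (f : X d → ℝ) (m₂ : ℝ → ℕ) : Prop :=
  ∀ ε : ℝ, 0 < ε → ∀ m : ℕ, m₂ ε ≤ m →
    ∫⁻ S, idealLoss d 2 (dataDist d f) S ∂(sampleDist d f m) ≤ ENNReal.ofReal ε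

/-- With probability at least `1 - δ` over a sample of size `m`, every possible output of the
`α`-approximate depth-3 threshold rule has population loss at most `ε`. (The measure of the
exceptional set is its outer measure, so no measurability of a selection is involved.) -/
def ThresholdThreeSucceeds (d : ℕ) (f : X d → ℝ) (α θ ε δ : ℝ) (m : ℕ) : Prop :=
  sampleDist d f m {S | ¬ ∀ g ∈ thresholdOutputs d 3 α θ S,
    popLoss (dataDist d f) g ≤ ENNReal.ofReal ε} ≤ ENNReal.ofReal δ

end

end DepthSep

/-!
Why depth three needs at most polynomially more samples than depth two.

*A cheap good network exists.* Take `n = max (m₂ (c ε / 16)) 1` samples. With probability at least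
`1 / 2` the first components of the points have pairwise distances `≥ n ^ (-2 / (d - 1)) / 8`
(`measure_not_separated_le`, from the cap bound `unifSphere_ball_le`), and then one ReLU ridge per
point interpolates the labels with squared parameter norm `O(n ^ ((d + 3) / (d - 1)))`
(`exists_interpolant`). A Pareto optimal function costs no more than an interpolant. As the ideal
rule has small expected loss, some separated sample has a Pareto optimal function with population
loss at most `c ε / 4` (`exists_cheap_net`). Placing a layer that computes the positive and negative
parts of the inputs below it makes it a depth-3 network `ψ` with squared norm
`O(d + n ^ ((d + 3) / (d - 1)))` (`Net.exists_depth_three`).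

*The outputs of the rule are as cheap as `ψ`.* Once the empirical loss of `ψ` is below the
threshold `c ε`, all outputs have squared norm at most `M`, which is `α` times that of `ψ` up to
constants, and empirical loss at most `α c ε < ε`. So it suffices that over the depth-3 networks of
squared norm at most `M` the empirical and the population loss differ by at most
`min (c / 2) (1 - α c) * ε` (`thresholdThreeSucceeds_of_net`).

*Uniform convergence* (`measure_uniform_deviation_le`): a deviation `t` has probability at most
`16 exp (-m t² / (K M ^ 6))`, for all widths and dimensions. The exponential moment of the supremum
of the deviations is symmetrized (`lintegral_exp_deviation_le`). The resulting Rademacher suprema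
are bounded by the Ledoux-Talagrand contraction principle for the exponential function
(`signSup_contraction`), which removes the loss and each ReLU layer (`signSup_reluHull_le`), until
only linear functions are left, for which Pinelis' inequality applies (`sum_cosh_norm_le`). Working
with exponential moments throughout gives the tail bound without a bounded difference inequality.
The scaling `M ^ 6` arises because the outputs and the Lipschitz constant of the loss on their range
are both `O(M ^ (3 / 2))`, and their product enters the variance proxy squared.
-/

namespace DepthSep

noncomputable section

/-! ### Exponential moments of Rademacher suprema -/

section SignSums

variable {ι κ : Type*} [Fintype ι] [DecidableEq ι]

/-- The value in `ℝ` of a sign. -/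
def sgn (u : ℤˣ) : ℝ := ((u : ℤ) : ℝ)

@[simp] lemma sgn_one : sgn 1 = 1 := by simp [sgn]

@[simp] lemma sgn_neg (u : ℤˣ) : sgn (-u) = -sgn u := by simp [sgn]

lemma sgn_cases (u : ℤˣ) : sgn u = 1 ∨ sgn u = -1 := by
  rcases Int.units_eq_one_or u with h | h <;> simp [h]

/-- The exponential moment of the supremum of the Rademacher sums `∑ i, ε i * T k i`, `k : κ`,
as a sum (not an average) over all sign vectors `ε`. Taking the suprema in `ℝ≥0∞` makes
boundedness assumptions unnecessary. -/
def signSup (T : κ → ι → ℝ) : ℝ≥0∞ :=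
  ∑ ε : ι → ℤˣ, ⨆ k, ENNReal.ofReal (Real.exp (∑ i, sgn (ε i) * T k i))

/-- Flipping the sign at one place. -/
def flipAt (a : ι) (ε : ι → ℤˣ) : ι → ℤˣ := Function.update ε a (-ε a)

omit [Fintype ι] in
lemma flipAt_flipAt (a : ι) (ε : ι → ℤˣ) : flipAt a (flipAt a ε) = ε := by
  simp [flipAt]

lemma sum_flipAt {M : Type*} [AddCommMonoid M] (a : ι) (F : (ι → ℤˣ) → M) :
    ∑ ε, F (flipAt a ε) = ∑ ε, F ε :=
  Equiv.sum_comp ⟨flipAt a, flipAt a, flipAt_flipAt a, flipAt_flipAt a⟩ F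

lemma sum_sgn_flipAt (a : ι) (ε : ι → ℤˣ) (v : ι → ℝ) :
    ∑ i, sgn (flipAt a ε i) * v i =
      ∑ i ∈ Finset.univ.erase a, sgn (ε i) * v i - sgn (ε a) * v a := by
  rw [← Finset.add_sum_erase _ _ (Finset.mem_univ a), sub_eq_add_neg, add_comm]
  congr 1
  · refine Finset.sum_congr rfl fun i hi => ?_
    rw [flipAt, Function.update_of_ne (Finset.ne_of_mem_erase hi)]
  · simp [flipAt]

lemma signSup_neg (T : κ → ι → ℝ) : signSup (fun k i => -T k i) = signSup T := by
  unfold signSup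
  rw [← Equiv.sum_comp (Equiv.neg (ι → ℤˣ))]
  simp

lemma card_signs : (Fintype.card (ι → ℤˣ) : ℝ≥0∞) = 2 ^ Fintype.card ι := by
  simp

lemma signSup_mono {κ' : Type*} {T : κ → ι → ℝ} {T' : κ' → ι → ℝ} (h : ∀ k', ∃ k, T k = T' k') :
    signSup T' ≤ signSup T := by
  refine Finset.sum_le_sum fun ε _ => iSup_le fun k' => ?_
  obtain ⟨k, hk⟩ := h k'
  rw [← hk]
  exact le_iSup (fun k => ENNReal.ofReal (Real.exp (∑ i, sgn (ε i) * T k i))) k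

lemma exp_increment_le {x y h k : ℝ} (hxy : x ≤ y) (hh : 0 ≤ h) (hk : h ≤ k) :
    Real.exp (x + h) - Real.exp x ≤ Real.exp (y + k) - Real.exp y := by
  have h1 : Real.exp x ≤ Real.exp y := Real.exp_le_exp.2 hxy
  have h2 : Real.exp h ≤ Real.exp k := Real.exp_le_exp.2 hk
  have h3 : 1 ≤ Real.exp h := Real.one_le_exp hh
  rw [Real.exp_add, Real.exp_add]
  nlinarith [Real.exp_pos x, Real.exp_pos y]

lemma exp_contraction_aux {a b p q s t : ℝ} (hp : |p| ≤ |s|) (hq : |q| ≤ |t|)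
    (hpq : |p - q| ≤ |s - t|) (h1 : b + q ≤ a + p) (h2 : a - p ≤ b - q) (hst : t ≤ s) :
    Real.exp (a + p) + Real.exp (b - q) ≤ Real.exp (a + s) + Real.exp (b - t) := by
  have hd : p - q ≤ s - t := by
    rw [abs_of_nonneg (sub_nonneg.2 hst)] at hpq
    exact (le_abs_self _).trans hpq
  rcases le_total 0 t with ht | ht
  · rw [abs_of_nonneg ht] at hq
    rw [abs_of_nonneg (ht.trans hst)] at hp
    have := exp_increment_le (x := b - t) (y := a + p) (h := t - q) (k := s - p)
      (by linarith [neg_abs_le q]) (by linarith [le_abs_self q]) (by linarith)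
    rw [show b - t + (t - q) = b - q by ring, show a + p + (s - p) = a + s by ring] at this
    linarith
  · rw [abs_of_nonpos ht] at hq
    rcases le_total 0 s with hs | hs
    · rw [abs_of_nonneg hs] at hp
      have e1 : Real.exp (a + p) ≤ Real.exp (a + s) :=
        Real.exp_le_exp.2 (by linarith [le_abs_self p])
      have e2 : Real.exp (b - q) ≤ Real.exp (b - t) :=
        Real.exp_le_exp.2 (by linarith [neg_abs_le q])
      linarith
    · rw [abs_of_nonpos hs] at hp
      have := exp_increment_le (x := a + s) (y := b - q) (h := p - s) (k := q - t)
        (by linarith [le_abs_self p]) (by linarith [neg_abs_le p]) (by linarith)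
      rw [show a + s + (p - s) = a + p by ring, show b - q + (q - t) = b - t by ring] at this
      linarith

lemma exp_add_exp_sub_le {b p t : ℝ} (h : |p| ≤ |t|) :
    Real.exp (b + p) + Real.exp (b - p) ≤ Real.exp (b + t) + Real.exp (b - t) := by
  have h1 : Real.cosh p ≤ Real.cosh t := Real.cosh_le_cosh.2 h
  rw [Real.cosh_eq, Real.cosh_eq] at h1
  simp only [Real.exp_add, sub_eq_add_neg]
  nlinarith [Real.exp_pos b]

/-- The two-point form of the contraction principle: two exponentials of contracted values are
dominated by one exponential with sign `+` and one with sign `-`, possibly at the same point. -/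
lemma exp_contraction {a b p q s t : ℝ} (hp : |p| ≤ |s|) (hq : |q| ≤ |t|)
    (hpq : |p - q| ≤ |s - t|) :
    Real.exp (a + p) + Real.exp (b - q) ≤
      max (Real.exp (a + s)) (Real.exp (b + t)) + max (Real.exp (a - s)) (Real.exp (b - t)) := by
  have l1 := le_max_left (Real.exp (a + s)) (Real.exp (b + t))
  have l2 := le_max_right (Real.exp (a + s)) (Real.exp (b + t))
  have l3 := le_max_left (Real.exp (a - s)) (Real.exp (b - t))
  have l4 := le_max_right (Real.exp (a - s)) (Real.exp (b - t))
  rcases le_total (a + p) (b + q) with h1 | h1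
  · have := Real.exp_le_exp.2 h1
    linarith [exp_add_exp_sub_le (b := b) hq]
  rcases le_total (b - q) (a - p) with h2 | h2
  · have := Real.exp_le_exp.2 h2
    linarith [exp_add_exp_sub_le (b := a) hp]
  rcases le_total t s with hst | hst
  · linarith [exp_contraction_aux hp hq hpq h1 h2 hst]
  · have := exp_contraction_aux (a := b) (b := a) (p := -q) (q := -p) (s := t) (t := s)
      (by simpa using hq) (by simpa using hp)
      (by rw [abs_sub_comm t s]; convert hpq using 2; ring) (by linarith) (by linarith) hst
    simp only [sub_neg_eq_add, ← sub_eq_add_neg] at this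
    linarith

lemma sup_contraction_step (A P S : κ → ℝ) (hP : ∀ k, |P k| ≤ |S k|)
    (hPP : ∀ k l, |P k - P l| ≤ |S k - S l|) :
    (⨆ k, ENNReal.ofReal (Real.exp (A k + P k))) + (⨆ k, ENNReal.ofReal (Real.exp (A k - P k))) ≤
      (⨆ k, ENNReal.ofReal (Real.exp (A k + S k))) +
        ⨆ k, ENNReal.ofReal (Real.exp (A k - S k)) := by
  rcases isEmpty_or_nonempty κ with _ | _
  · simp
  refine ENNReal.iSup_add_iSup_le fun k l => ?_
  rw [← ENNReal.ofReal_add (Real.exp_pos _).le (Real.exp_pos _).le]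
  refine (ENNReal.ofReal_le_ofReal (exp_contraction (hP k) (hP l) (hPP k l))).trans ?_
  rw [ENNReal.ofReal_add (by positivity) (by positivity), ENNReal.ofReal_max, ENNReal.ofReal_max]
  refine add_le_add (max_le ?_ ?_) (max_le ?_ ?_)
  · exact le_iSup (fun k => ENNReal.ofReal (Real.exp (A k + S k))) k
  · exact le_iSup (fun k => ENNReal.ofReal (Real.exp (A k + S k))) l
  · exact le_iSup (fun k => ENNReal.ofReal (Real.exp (A k - S k))) k
  · exact le_iSup (fun k => ENNReal.ofReal (Real.exp (A k - S k))) l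

/-- The contraction principle of Ledoux and Talagrand, for the exponential function. -/
lemma signSup_contraction (T T' : κ → ι → ℝ) (h0 : ∀ k i, |T' k i| ≤ |T k i|)
    (h1 : ∀ k l i, |T' k i - T' l i| ≤ |T k i - T l i|) : signSup T' ≤ signSup T := by
  classical
  -- The coordinates are replaced one at a time.
  have key : ∀ s : Finset ι, signSup (fun k i => if i ∈ s then T' k i else T k i) ≤ signSup T := by
    intro s
    induction s using Finset.induction_on with
    | empty => simp
    | insert a s ha ih =>
      refine le_trans ?_ ih
      -- Averaging over the flip at `a` turns the claim into the two-point inequality.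
      have dbl : ∀ F : (ι → ℤˣ) → ℝ≥0∞, 2 * ∑ ε, F ε = ∑ ε, (F ε + F (flipAt a ε)) := by
        intro F
        rw [Finset.sum_add_distrib, sum_flipAt, two_mul]
      have two : (2 : ℝ≥0∞) * signSup (fun k i => if i ∈ insert a s then T' k i else T k i) ≤
          2 * signSup (fun k i => if i ∈ s then T' k i else T k i) := by
        unfold signSup
        rw [dbl, dbl]
        refine Finset.sum_le_sum fun ε _ => ?_
        simp only [sum_sgn_flipAt]
        simp only [← Finset.sum_erase_add _ _ (Finset.mem_univ a)]
        have e : ∀ k, ∑ i ∈ Finset.univ.erase a,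
              sgn (ε i) * (if i ∈ insert a s then T' k i else T k i) =
            ∑ i ∈ Finset.univ.erase a, sgn (ε i) * (if i ∈ s then T' k i else T k i) := by
          intro k
          refine Finset.sum_congr rfl fun i hi => ?_
          simp [Finset.mem_insert, Finset.ne_of_mem_erase hi]
        simp only [e, ha, if_false, Finset.mem_insert_self, if_true]
        refine sup_contraction_step _ (fun k => sgn (ε a) * T' k a) (fun k => sgn (ε a) * T k a)
          (fun k => ?_) fun k l => ?_
        · rcases sgn_cases (ε a) with h | h <;> simpa [h] using h0 k a
        · rw [← mul_sub, ← mul_sub, abs_mul, abs_mul]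
          exact mul_le_mul_of_nonneg_left (h1 k l a) (abs_nonneg _)
      exact (ENNReal.mul_le_mul_iff_right (by simp) (by simp)).1 two
  simpa using key Finset.univ

/-- The elementary inequality `2xy ≤ x² + y²` for exponentials, under a supremum. -/
lemma iSup_exp_add_le (a b : κ → ℝ) :
    (⨆ k, ENNReal.ofReal (Real.exp (a k + b k))) ≤
      2⁻¹ * ((⨆ k, ENNReal.ofReal (Real.exp (2 * a k))) +
        ⨆ k, ENNReal.ofReal (Real.exp (2 * b k))) := by
  refine iSup_le fun k => ?_
  have h : Real.exp (a k + b k) ≤ 2⁻¹ * (Real.exp (2 * a k) + Real.exp (2 * b k)) := by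
    rw [Real.exp_add, two_mul, two_mul, Real.exp_add, Real.exp_add]
    nlinarith [sq_nonneg (Real.exp (a k) - Real.exp (b k))]
  refine (ENNReal.ofReal_le_ofReal h).trans ?_
  rw [ENNReal.ofReal_mul (by norm_num), ENNReal.ofReal_add (by positivity) (by positivity),
    ENNReal.ofReal_inv_of_pos (by norm_num), ENNReal.ofReal_ofNat]
  gcongr
  · exact le_iSup (fun k => ENNReal.ofReal (Real.exp (2 * a k))) k
  · exact le_iSup (fun k => ENNReal.ofReal (Real.exp (2 * b k))) k

lemma signSup_add_le (T T' : κ → ι → ℝ) :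
    signSup (fun k i => T k i + T' k i) ≤
      2⁻¹ * (signSup (fun k i => 2 * T k i) + signSup (fun k i => 2 * T' k i)) := by
  unfold signSup
  rw [← Finset.sum_add_distrib, Finset.mul_sum]
  refine Finset.sum_le_sum fun ε _ => ?_
  have e : ∀ (v : κ → ι → ℝ) k, ∑ i, sgn (ε i) * (2 * v k i) = 2 * ∑ i, sgn (ε i) * v k i := by
    intro v k
    rw [Finset.mul_sum]
    exact Finset.sum_congr rfl fun i _ => by ring
  simp only [mul_add, Finset.sum_add_distrib, e]
  exact (iSup_exp_add_le _ _).trans (by rw [mul_add])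

/-- The functions `∑ k, c k * relu (a k)` with `∑ k, |c k| ≤ R` and `a k ∈ A`. -/
def reluHull {Y : Type*} (R : ℝ) (A : Set (Y → ℝ)) : Set (Y → ℝ) :=
  {g | ∃ (n : ℕ) (c : Fin n → ℝ) (a : Fin n → Y → ℝ), (∀ k, a k ∈ A) ∧ ∑ k, |c k| ≤ R ∧
    ∀ y, g y = ∑ k, c k * max (a k y) 0}

lemma abs_le_of_mem_reluHull {Y : Type*} {R K : ℝ} {A : Set (Y → ℝ)} (hK : 0 ≤ K)
    (hA : ∀ a ∈ A, ∀ y, |a y| ≤ K) {g : Y → ℝ} (hg : g ∈ reluHull R A) (y : Y) :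
    |g y| ≤ R * K := by
  obtain ⟨n, c, a, ha, hc, hg⟩ := hg
  rw [hg]
  calc |∑ k, c k * max (a k y) 0| ≤ ∑ k, |c k * max (a k y) 0| := Finset.abs_sum_le_sum_abs _ _
    _ ≤ ∑ k, |c k| * K := by
        refine Finset.sum_le_sum fun k _ => ?_
        rw [abs_mul]
        refine mul_le_mul_of_nonneg_left ?_ (abs_nonneg _)
        rw [abs_of_nonneg (le_max_right _ _)]
        exact max_le ((le_abs_self _).trans (hA _ (ha k) y)) hK
    _ ≤ R * K := by rw [← Finset.sum_mul]; exact mul_le_mul_of_nonneg_right hc hK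

/-- Peeling off a layer: the exponential moment of a hull of ReLU units is controlled by that of
the preactivations. A linear functional on the hull is maximal at a single unit, up to sign, and
the ReLU is a contraction. -/
lemma signSup_reluHull_le {Y : Type*} {R t : ℝ} {A : Set (Y → ℝ)} (ht : 0 ≤ t) (hR : 0 ≤ R)
    (hA : A.Nonempty) (x : ι → Y) :
    signSup (fun (h : reluHull R A) i => t * h.1 (x i)) ≤
      2 * signSup (fun (a : A) i => t * R * a.1 (x i)) := by
  have hcontr : signSup (fun (a : A) i => t * R * max (a.1 (x i)) 0) ≤
      signSup (fun (a : A) i => t * R * a.1 (x i)) := by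
    refine signSup_contraction _ _ (fun a i => ?_) fun a b i => ?_
    · rw [abs_mul (t * R), abs_mul (t * R)]
      refine mul_le_mul_of_nonneg_left ?_ (abs_nonneg _)
      have := abs_max_sub_max_le_abs (a.1 (x i)) 0 0
      simpa using this
    · rw [← mul_sub, ← mul_sub, abs_mul (t * R), abs_mul (t * R)]
      exact mul_le_mul_of_nonneg_left (abs_max_sub_max_le_abs _ _ _) (abs_nonneg _)
  refine le_trans ?_ (mul_le_mul_right hcontr 2)
  rw [two_mul]
  nth_rewrite 2 [← signSup_neg]
  unfold signSup
  rw [← Finset.sum_add_distrib]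
  refine Finset.sum_le_sum fun ε _ => iSup_le fun h => ?_
  obtain ⟨n, c, a, ha, hc, hg⟩ := h.2
  set Z : A → ℝ := fun a => ∑ i, sgn (ε i) * max (a.1 (x i)) 0 with hZ
  have hsum : ∑ i, sgn (ε i) * (t * h.1 (x i)) = t * ∑ k, c k * Z ⟨a k, ha k⟩ := by
    simp only [hg, hZ, Finset.mul_sum]
    rw [Finset.sum_comm]
    exact Finset.sum_congr rfl fun k _ => Finset.sum_congr rfl fun i _ => by ring
  obtain ⟨b, hb⟩ : ∃ b : A, t * ∑ k, c k * Z ⟨a k, ha k⟩ ≤ t * R * |Z b| := by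
    rcases Nat.eq_zero_or_pos n with rfl | hn
    · obtain ⟨b, hb⟩ := hA
      exact ⟨⟨b, hb⟩, by simp; positivity⟩
    · have : Nonempty (Fin n) := ⟨⟨0, hn⟩⟩
      obtain ⟨k0, hk0⟩ := Finite.exists_max (fun k => |Z ⟨a k, ha k⟩|)
      refine ⟨⟨a k0, ha k0⟩, ?_⟩
      rw [mul_assoc]
      refine mul_le_mul_of_nonneg_left ?_ ht
      calc ∑ k, c k * Z ⟨a k, ha k⟩ ≤ ∑ k, |c k| * |Z ⟨a k0, ha k0⟩| := by
            refine Finset.sum_le_sum fun k _ => (le_abs_self _).trans ?_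
            rw [abs_mul]
            exact mul_le_mul_of_nonneg_left (hk0 k) (abs_nonneg _)
        _ ≤ R * |Z ⟨a k0, ha k0⟩| := by
            rw [← Finset.sum_mul]; exact mul_le_mul_of_nonneg_right hc (abs_nonneg _)
  rw [hsum]
  refine (ENNReal.ofReal_le_ofReal (Real.exp_le_exp.2 hb)).trans ?_
  have e1 : ∀ b : A, ∑ i, sgn (ε i) * (t * R * max (b.1 (x i)) 0) = t * R * Z b := by
    intro b
    simp only [hZ, Finset.mul_sum]
    exact Finset.sum_congr rfl fun i _ => by ring
  have e2 : ∀ b : A, ∑ i, sgn (ε i) * -(t * R * max (b.1 (x i)) 0) = t * R * -Z b := by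
    intro b
    rw [mul_neg, ← e1, ← Finset.sum_neg_distrib]
    exact Finset.sum_congr rfl fun i _ => by ring
  simp only [e1, e2]
  rcases abs_cases (Z b) with ⟨h, _⟩ | ⟨h, _⟩ <;> rw [h]
  · exact le_add_left (le_iSup (fun b => ENNReal.ofReal (Real.exp (t * R * Z b))) b)
  · exact le_add_right (le_iSup (fun b => ENNReal.ofReal (Real.exp (t * R * -Z b))) b)

/-! ### Norms of Rademacher sums in Hilbert space -/

lemma pow_add_pow_le {u v U V : ℝ} (hV : 0 ≤ V) (hVu : V ≤ u) (huU : u ≤ U) (h : u + v = U + V)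
    (n : ℕ) : u ^ n + v ^ n ≤ U ^ n + V ^ n := by
  have hv : v = U + V - u := by linarith
  have hf := (convexOn_pow (𝕜 := ℝ) n).2
  rcases eq_or_lt_of_le (hVu.trans huU) with hUV | hUV
  · have h1 : u = U := le_antisymm huU (hUV ▸ hVu)
    have h2 : v = V := by linarith
    rw [h1, h2]
  · set w := (u - V) / (U - V)
    have hw0 : 0 ≤ w := div_nonneg (by linarith) (by linarith)
    have hw1 : w ≤ 1 := (div_le_one (by linarith)).2 (by linarith)
    have hwe : w * (U - V) = u - V := div_mul_cancel₀ _ (by linarith)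
    have a1 := hf (x := U) (y := V) (by simp; linarith) (by simpa using hV) hw0
      (sub_nonneg.2 hw1) (by ring)
    have a2 := hf (x := U) (y := V) (by simp; linarith) (by simpa using hV) (sub_nonneg.2 hw1) hw0
      (by ring)
    simp only [smul_eq_mul] at a1 a2
    rw [show w * U + (1 - w) * V = u by linarith] at a1
    rw [show (1 - w) * U + w * V = v by linarith] at a2
    linarith

/-- Pinelis' inequality, which makes the exponential moment of the norm of a Rademacher sum
tensorize: `cosh ∘ sqrt` is convex because its power series has nonnegative coefficients. -/
lemma cosh_norm_add_add_cosh_norm_sub_le {E : Type*} [NormedAddCommGroup E]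
    [InnerProductSpace ℝ E] (s v : E) :
    Real.cosh ‖s + v‖ + Real.cosh ‖s - v‖ ≤ 2 * (Real.cosh ‖s‖ * Real.cosh ‖v‖) := by
  have key : Real.cosh ‖s + v‖ + Real.cosh ‖s - v‖ ≤
      Real.cosh (‖s‖ + ‖v‖) + Real.cosh (‖s‖ - ‖v‖) := by
    refine hasSum_le (fun n => ?_) ((Real.hasSum_cosh _).add (Real.hasSum_cosh _))
      ((Real.hasSum_cosh _).add (Real.hasSum_cosh _))
    rw [← add_div, ← add_div]
    refine div_le_div_of_nonneg_right ?_ (by positivity)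
    simp only [pow_mul]
    refine pow_add_pow_le (sq_nonneg _) ?_ ?_ ?_ n
    · refine sq_le_sq.2 ?_
      rw [abs_of_nonneg (norm_nonneg (s + v))]
      simpa using abs_norm_sub_norm_le s (-v)
    · exact pow_le_pow_left₀ (norm_nonneg _) (norm_add_le _ _) 2
    · have := parallelogram_law_with_norm ℝ s v
      nlinarith
  rw [Real.cosh_add, Real.cosh_sub] at key
  linarith

lemma sum_cosh_norm_le {E : Type*} [NormedAddCommGroup E] [InnerProductSpace ℝ E] (v : ι → E) :
    ∑ ε : ι → ℤˣ, Real.cosh ‖∑ i, sgn (ε i) • v i‖ ≤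
      2 ^ Fintype.card ι * ∏ i, Real.cosh ‖v i‖ := by
  classical
  have key : ∀ s : Finset ι, ∑ ε : ι → ℤˣ, Real.cosh ‖∑ i ∈ s, sgn (ε i) • v i‖ ≤
      2 ^ Fintype.card ι * ∏ i ∈ s, Real.cosh ‖v i‖ := by
    intro s
    induction s using Finset.induction_on with
    | empty => simp
    | insert a s ha ih =>
      have step : 2 * ∑ ε : ι → ℤˣ, Real.cosh ‖∑ i ∈ insert a s, sgn (ε i) • v i‖ ≤
          2 * (Real.cosh ‖v a‖ * ∑ ε : ι → ℤˣ, Real.cosh ‖∑ i ∈ s, sgn (ε i) • v i‖) := by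
        rw [two_mul]
        nth_rewrite 2 [← sum_flipAt a]
        rw [← Finset.sum_add_distrib, Finset.mul_sum, Finset.mul_sum]
        refine Finset.sum_le_sum fun ε _ => ?_
        have e : ∑ i ∈ s, sgn (flipAt a ε i) • v i = ∑ i ∈ s, sgn (ε i) • v i := by
          refine Finset.sum_congr rfl fun i hi => ?_
          rw [flipAt, Function.update_of_ne (ne_of_mem_of_not_mem hi ha)]
        have e2 : sgn (flipAt a ε a) = -sgn (ε a) := by simp [flipAt]
        rw [Finset.sum_insert ha, Finset.sum_insert ha, e, e2]
        have := cosh_norm_add_add_cosh_norm_sub_le (∑ i ∈ s, sgn (ε i) • v i) (v a)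
        rcases sgn_cases (ε a) with h | h <;> rw [h] <;>
          simp only [one_smul, neg_smul, neg_neg, neg_add_eq_sub, add_comm (v a)] <;> linarith
      rw [Finset.prod_insert ha]
      have hc := Real.cosh_pos (‖v a‖)
      nlinarith
  exact key Finset.univ

/-- The exponential moment of the family of all linear functionals of norm at most one. -/
lemma signSup_inner_le {E : Type*} [NormedAddCommGroup E] [InnerProductSpace ℝ E] (v : ι → E)
    {K : ℝ} (hv : ∀ i, ‖v i‖ ≤ K) {T : κ → ι → ℝ}
    (hT : ∀ k, ∃ w : E, ‖w‖ ≤ 1 ∧ ∀ i, T k i = inner ℝ w (v i)) :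
    signSup T ≤ 2 ^ Fintype.card ι *
      ENNReal.ofReal (2 * Real.exp (Fintype.card ι * (K ^ 2 / 2))) := by
  have h1 : signSup T ≤ ∑ ε : ι → ℤˣ, ENNReal.ofReal (2 * Real.cosh ‖∑ i, sgn (ε i) • v i‖) := by
    refine Finset.sum_le_sum fun ε _ => iSup_le fun k => ENNReal.ofReal_le_ofReal ?_
    obtain ⟨w, hw, hk⟩ := hT k
    have e : ∑ i, sgn (ε i) * T k i = inner ℝ w (∑ i, sgn (ε i) • v i) := by
      rw [inner_sum]
      exact Finset.sum_congr rfl fun i _ => by rw [hk, inner_smul_right]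
    have e2 : ∑ i, sgn (ε i) * T k i ≤ ‖∑ i, sgn (ε i) • v i‖ := by
      rw [e]
      refine (real_inner_le_norm _ _).trans ?_
      exact mul_le_of_le_one_left (norm_nonneg _) hw
    refine (Real.exp_le_exp.2 e2).trans ?_
    rw [Real.cosh_eq]
    linarith [Real.exp_pos (-‖∑ i, sgn (ε i) • v i‖)]
  refine h1.trans ?_
  rw [← ENNReal.ofReal_sum_of_nonneg (fun ε _ => by positivity), ← Finset.mul_sum,
    show (2 : ℝ≥0∞) ^ Fintype.card ι = ENNReal.ofReal (2 ^ Fintype.card ι) by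
      rw [ENNReal.ofReal_pow (by norm_num)]; simp,
    ← ENNReal.ofReal_mul (by positivity)]
  refine ENNReal.ofReal_le_ofReal ?_
  have h2 : ∏ i, Real.cosh ‖v i‖ ≤ Real.exp (Fintype.card ι * (K ^ 2 / 2)) := by
    calc ∏ i, Real.cosh ‖v i‖ ≤ ∏ _i : ι, Real.exp (K ^ 2 / 2) := by
          refine Finset.prod_le_prod (fun i _ => (Real.cosh_pos _).le) fun i _ => ?_
          refine (Real.cosh_le_exp_half_sq _).trans (Real.exp_le_exp.2 ?_)
          have := pow_le_pow_left₀ (norm_nonneg _) (hv i) 2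
          linarith
      _ = _ := by rw [Finset.prod_const, Finset.card_univ, ← Real.exp_nat_mul]
  have h3 := sum_cosh_norm_le v
  have h4 : (0 : ℝ) < 2 ^ Fintype.card ι := by positivity
  nlinarith

end SignSums

/-! ### Symmetrization and uniform deviations -/

section Symmetrization

variable {Z κ ι : Type*} [MeasurableSpace Z] [Fintype ι] [DecidableEq ι]

lemma ofReal_exp_integral_le {Ω : Type*} [MeasurableSpace Ω] {P : Measure Ω}
    [IsProbabilityMeasure P] {f : Ω → ℝ} (hf : Measurable f) {K : ℝ} (hK : ∀ ω, |f ω| ≤ K) :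
    ENNReal.ofReal (Real.exp (∫ ω, f ω ∂P)) ≤ ∫⁻ ω, ENNReal.ofReal (Real.exp (f ω)) ∂P := by
  have h1 : Integrable f P :=
    Integrable.of_bound hf.aestronglyMeasurable K (Filter.Eventually.of_forall hK)
  have h2 : Integrable (fun ω => Real.exp (f ω)) P := by
    refine Integrable.of_bound (Real.measurable_exp.comp hf).aestronglyMeasurable (Real.exp K)
      (Filter.Eventually.of_forall fun ω => ?_)
    rw [Real.norm_eq_abs, Real.abs_exp]
    exact Real.exp_le_exp.2 ((le_abs_self _).trans (hK ω))
  rw [← ofReal_integral_eq_lintegral_ofReal h2 (Filter.Eventually.of_forall fun _ =>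
    (Real.exp_pos _).le)]
  refine ENNReal.ofReal_le_ofReal ?_
  exact convexOn_exp.map_integral_le Real.continuous_exp.continuousOn isClosed_univ
    (Filter.Eventually.of_forall fun _ => mem_univ _) h1 h2

lemma measurable_signSup [Countable κ] {ℓ : κ → Z → ℝ} (hm : ∀ k, Measurable (ℓ k)) :
    Measurable fun S : ι → Z => signSup fun k i => ℓ k (S i) := by
  unfold signSup
  refine Finset.measurable_sum _ fun ε _ => Measurable.iSup fun k => ?_
  fun_prop

omit [DecidableEq ι] in
lemma lintegral_pi_map {W : Type*} [MeasurableSpace W] (D : Measure Z) [IsProbabilityMeasure D]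
    (D' : Measure W) [IsProbabilityMeasure D'] {h : ι → Z → W}
    (hh : ∀ i, MeasurePreserving (h i) D D') {F : (ι → W) → ℝ≥0∞} (hF : Measurable F) :
    ∫⁻ S, F (fun i => h i (S i)) ∂(Measure.pi fun _ : ι => D) =
      ∫⁻ S, F S ∂(Measure.pi fun _ : ι => D') :=
  (measurePreserving_pi _ _ hh).lintegral_comp hF

omit [DecidableEq ι] in
/-- The true means are replaced by the empirical means of a second, independent sample. -/
lemma lintegral_exp_deviation_le_ghost [Countable κ] (D : Measure Z) [IsProbabilityMeasure D]
    {ℓ : κ → Z → ℝ} (hm : ∀ k, Measurable (ℓ k)) (hb : ∀ k, ∃ K, ∀ z, |ℓ k z| ≤ K) :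
    ∫⁻ S : ι → Z, ⨆ k, ENNReal.ofReal (Real.exp (∑ i, ((∫ z, ℓ k z ∂D) - ℓ k (S i))))
        ∂(Measure.pi fun _ => D) ≤
      ∫⁻ q : ι → Z × Z, ⨆ k, ENNReal.ofReal (Real.exp (∑ i, (ℓ k (q i).1 - ℓ k (q i).2)))
        ∂(Measure.pi fun _ => D.prod D) := by
  set P : Measure (ι → Z) := Measure.pi fun _ => D with hP
  have e : ∫⁻ q : ι → Z × Z, ⨆ k, ENNReal.ofReal (Real.exp (∑ i, (ℓ k (q i).1 - ℓ k (q i).2)))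
        ∂(Measure.pi fun _ => D.prod D) =
      ∫⁻ S, ∫⁻ S', ⨆ k, ENNReal.ofReal (Real.exp (∑ i, (ℓ k (S' i) - ℓ k (S i)))) ∂P ∂P := by
    have hF : Measurable fun p : (ι → Z) × (ι → Z) =>
        ⨆ k, ENNReal.ofReal (Real.exp (∑ i, (ℓ k (p.2 i) - ℓ k (p.1 i)))) :=
      Measurable.iSup fun k => by fun_prop
    have hF2 : Measurable fun p : (ι → Z) × (ι → Z) =>
        ⨆ k, ENNReal.ofReal (Real.exp (∑ i, (ℓ k (p.1 i) - ℓ k (p.2 i)))) :=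
      Measurable.iSup fun k => by fun_prop
    rw [← lintegral_prod _ hF.aemeasurable, ← lintegral_prod_swap]
    exact (measurePreserving_arrowProdEquivProdArrow Z Z ι (fun _ => D)
      (fun _ => D)).lintegral_comp hF2
  rw [e]
  refine lintegral_mono fun S => iSup_le fun k => ?_
  obtain ⟨K, hK⟩ := hb k
  have hi : ∑ i, ((∫ z, ℓ k z ∂D) - ℓ k (S i)) =
      ∫ S' : ι → Z, ∑ i, (ℓ k (S' i) - ℓ k (S i)) ∂P := by
    have hI : ∀ i : ι, Integrable (fun S' : ι → Z => ℓ k (S' i)) P := fun i =>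
      Integrable.of_bound ((hm k).comp (measurable_pi_apply i)).aestronglyMeasurable K
        (Filter.Eventually.of_forall fun _ => hK _)
    have hI2 : ∀ i ∈ Finset.univ, Integrable (fun S' : ι → Z => ℓ k (S' i) - ℓ k (S i)) P :=
      fun i _ => (hI i).sub (integrable_const _)
    rw [integral_finsetSum _ hI2]
    refine Finset.sum_congr rfl fun i _ => ?_
    rw [integral_sub (hI i) (integrable_const _)]
    congr 1
    · exact (integral_comp_eval (μ := fun _ : ι => D) (hm k).aestronglyMeasurable).symm
    · simp
  rw [hi]
  refine (ofReal_exp_integral_le (P := P) (K := Fintype.card ι * (K + K)) (by fun_prop)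
    fun S' => ?_).trans (lintegral_mono fun S' => ?_)
  · refine (Finset.abs_sum_le_sum_abs _ _).trans ?_
    refine (Finset.sum_le_card_nsmul _ _ (K + K) fun i _ => ?_).trans (by simp [mul_add])
    exact (abs_sub _ _).trans (add_le_add (hK _) (hK _))
  · exact le_iSup (fun k => ENNReal.ofReal (Real.exp (∑ i, (ℓ k (S' i) - ℓ k (S i))))) k

omit [DecidableEq ι] in
/-- Exchanging the two samples at the places where `ε = -1` does not change their law. -/
lemma lintegral_exp_swap [Countable κ] (D : Measure Z) [IsProbabilityMeasure D]
    {ℓ : κ → Z → ℝ} (hm : ∀ k, Measurable (ℓ k)) (ε : ι → ℤˣ) :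
    ∫⁻ q : ι → Z × Z,
        ⨆ k, ENNReal.ofReal (Real.exp (∑ i, sgn (ε i) * (ℓ k (q i).1 - ℓ k (q i).2)))
        ∂(Measure.pi fun _ => D.prod D) =
      ∫⁻ q : ι → Z × Z, ⨆ k, ENNReal.ofReal (Real.exp (∑ i, (ℓ k (q i).1 - ℓ k (q i).2)))
        ∂(Measure.pi fun _ => D.prod D) := by
  have hF : Measurable fun q : ι → Z × Z =>
      ⨆ k, ENNReal.ofReal (Real.exp (∑ i, (ℓ k (q i).1 - ℓ k (q i).2))) :=
    Measurable.iSup fun k => by fun_prop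
  rw [← lintegral_pi_map (ι := ι) (D.prod D) (D.prod D)
    (h := fun i => if ε i = 1 then id else Prod.swap) (fun i => by
      split_ifs
      · exact MeasurePreserving.id _
      · exact Measure.measurePreserving_swap) hF]
  refine lintegral_congr fun q => iSup_congr fun k => ?_
  congr 2
  refine Finset.sum_congr rfl fun i _ => ?_
  rcases Int.units_eq_one_or (ε i) with h | h <;> simp [h]

/-- Symmetrization for exponential moments: the deviation of the empirical from the true means,
uniformly over a countable family, is controlled by Rademacher sums. -/
lemma lintegral_exp_deviation_le [Countable κ] (D : Measure Z) [IsProbabilityMeasure D]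
    {ℓ : κ → Z → ℝ} (hm : ∀ k, Measurable (ℓ k)) (hb : ∀ k, ∃ K, ∀ z, |ℓ k z| ≤ K) :
    ∫⁻ S : ι → Z, ⨆ k, ENNReal.ofReal (Real.exp (∑ i, ((∫ z, ℓ k z ∂D) - ℓ k (S i))))
        ∂(Measure.pi fun _ => D) ≤
      (2 ^ Fintype.card ι)⁻¹ *
        ∫⁻ S : ι → Z, signSup (fun k i => 2 * ℓ k (S i)) ∂(Measure.pi fun _ => D) := by
  refine (lintegral_exp_deviation_le_ghost D hm hb).trans ?_
  set Q : Measure (ι → Z × Z) := Measure.pi fun _ => D.prod D with hQ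
  set w := ∫⁻ q : ι → Z × Z, ⨆ k, ENNReal.ofReal (Real.exp (∑ i, (ℓ k (q i).1 - ℓ k (q i).2))) ∂Q
  have h3 : ∑ ε : ι → ℤˣ, ∫⁻ q : ι → Z × Z,
      ⨆ k, ENNReal.ofReal (Real.exp (∑ i, sgn (ε i) * (ℓ k (q i).1 - ℓ k (q i).2))) ∂Q =
      2 ^ Fintype.card ι * w := by
    rw [Finset.sum_congr rfl fun ε _ => lintegral_exp_swap D hm ε, Finset.sum_const,
      Finset.card_univ, nsmul_eq_mul, card_signs]
  have hmeas : Measurable fun S : ι → Z => signSup fun k i => 2 * ℓ k (S i) :=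
    measurable_signSup (ℓ := fun k z => 2 * ℓ k z) fun k => (hm k).const_mul 2
  have h4 : 2 ^ Fintype.card ι * w ≤
      ∫⁻ S, signSup (fun k i => 2 * ℓ k (S i)) ∂(Measure.pi fun _ : ι => D) := by
    have hW : ∀ ε : ι → ℤˣ, Measurable fun q : ι → Z × Z =>
        ⨆ k, ENNReal.ofReal (Real.exp (∑ i, sgn (ε i) * (ℓ k (q i).1 - ℓ k (q i).2))) :=
      fun ε => Measurable.iSup fun k => by fun_prop
    have h5 := lintegral_finsetSum (μ := Q) Finset.univ fun ε _ => hW ε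
    rw [← h3, ← h5]
    have : ∀ q : ι → Z × Z,
        ∑ ε : ι → ℤˣ, (⨆ k,
          ENNReal.ofReal (Real.exp (∑ i, sgn (ε i) * (ℓ k (q i).1 - ℓ k (q i).2)))) ≤
        2⁻¹ * (signSup (fun k i => 2 * ℓ k (q i).1) + signSup (fun k i => 2 * ℓ k (q i).2)) := by
      intro q
      have a := signSup_add_le (fun k i => ℓ k (q i).1) (fun k i => -ℓ k (q i).2)
      have b := signSup_neg (fun k i => 2 * ℓ k (q i).2)
      simp only [mul_neg] at a
      rw [b] at a
      simp only [← sub_eq_add_neg] at a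
      exact a
    refine (lintegral_mono this).trans ?_
    have m1 : Measurable fun q : ι → Z × Z => signSup fun k i => 2 * ℓ k (q i).1 :=
      hmeas.comp (g := fun S : ι → Z => signSup fun k i => 2 * ℓ k (S i))
        (f := fun (q : ι → Z × Z) i => (q i).1) (by fun_prop)
    have m2 : Measurable fun q : ι → Z × Z => signSup fun k i => 2 * ℓ k (q i).2 :=
      hmeas.comp (g := fun S : ι → Z => signSup fun k i => 2 * ℓ k (S i))
        (f := fun (q : ι → Z × Z) i => (q i).2) (by fun_prop)
    rw [lintegral_const_mul' _ _ (by simp), lintegral_add_left m1]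
    have e1 := lintegral_pi_map (ι := ι) (D.prod D) D (h := fun _ => Prod.fst)
      (fun _ => measurePreserving_fst) hmeas
    have e2 := lintegral_pi_map (ι := ι) (D.prod D) D (h := fun _ => Prod.snd)
      (fun _ => measurePreserving_snd) hmeas
    rw [hQ, e1, e2, ← two_mul, ← mul_assoc, ENNReal.inv_mul_cancel (by simp) (by simp), one_mul]
  rw [mul_comm, ← div_eq_mul_inv, ENNReal.le_div_iff_mul_le (by simp) (by simp), mul_comm]
  exact h4

/-- A uniform Chernoff bound, from sub-Gaussian exponential moments of the Rademacher suprema. -/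
lemma measure_deviation_le [Countable κ] (D : Measure Z) [IsProbabilityMeasure D]
    {ℓ : κ → Z → ℝ} (hm : ∀ k, Measurable (ℓ k)) (hb : ∀ k, ∃ K, ∀ z, |ℓ k z| ≤ K)
    {Q A t : ℝ} (hQ : 0 < Q) (ht : 0 < t)
    (hR : ∀ (S : ι → Z) (s : ℝ), 0 ≤ s → signSup (fun k i => s * ℓ k (S i)) ≤
      2 ^ Fintype.card ι * ENNReal.ofReal (A * Real.exp (Fintype.card ι * (Q * s ^ 2)))) :
    (Measure.pi fun _ : ι => D)
        {S | ∃ k, Fintype.card ι * t < ∑ i, ((∫ z, ℓ k z ∂D) - ℓ k (S i))} ≤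
      ENNReal.ofReal (A * Real.exp (-(Fintype.card ι * (t ^ 2 / (16 * Q))))) := by
  set m : ℝ := (Fintype.card ι : ℝ) with hmdef
  set l : ℝ := t / (8 * Q) with hl
  have hl0 : 0 < l := by positivity
  set F : (ι → Z) → ℝ≥0∞ := fun S =>
    ⨆ k, ENNReal.ofReal (Real.exp (∑ i, ((∫ z, l * ℓ k z ∂D) - l * ℓ k (S i)))) with hF
  have hFm : Measurable F := Measurable.iSup fun k => by fun_prop
  have hsym : ∫⁻ S, F S ∂(Measure.pi fun _ : ι => D) ≤
      ENNReal.ofReal (A * Real.exp (m * (Q * (2 * l) ^ 2))) := by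
    refine (lintegral_exp_deviation_le D (fun k => (hm k).const_mul l) fun k => ?_).trans ?_
    · obtain ⟨K, hK⟩ := hb k
      refine ⟨|l| * K, fun z => ?_⟩
      rw [abs_mul]
      exact mul_le_mul_of_nonneg_left (hK z) (abs_nonneg _)
    · have : ∫⁻ S : ι → Z, signSup (fun k i => 2 * (l * ℓ k (S i))) ∂(Measure.pi fun _ => D) ≤
          2 ^ Fintype.card ι * ENNReal.ofReal (A * Real.exp (m * (Q * (2 * l) ^ 2))) := by
        refine (lintegral_mono fun S => ?_).trans (by rw [lintegral_const, measure_univ, mul_one])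
        simp only [← mul_assoc 2 l]
        exact hR S (2 * l) (by positivity)
      refine (mul_le_mul_right this _).trans ?_
      rw [← mul_assoc, ENNReal.inv_mul_cancel (by simp) (by simp), one_mul]
  have hsub : {S : ι → Z | ∃ k, m * t < ∑ i, ((∫ z, ℓ k z ∂D) - ℓ k (S i))} ⊆
      {S | ENNReal.ofReal (Real.exp (l * (m * t))) ≤ F S} := by
    rintro S ⟨k, hk⟩
    refine le_trans (ENNReal.ofReal_le_ofReal (Real.exp_le_exp.2 ?_))
      (le_iSup (fun k => ENNReal.ofReal
      (Real.exp (∑ i, ((∫ z, l * ℓ k z ∂D) - l * ℓ k (S i))))) k)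
    have : ∑ i, ((∫ z, l * ℓ k z ∂D) - l * ℓ k (S i)) = l * ∑ i, ((∫ z, ℓ k z ∂D) - ℓ k (S i)) := by
      rw [Finset.mul_sum, integral_const_mul]
      exact Finset.sum_congr rfl fun i _ => by ring
    rw [this]
    exact mul_le_mul_of_nonneg_left hk.le hl0.le
  refine (measure_mono hsub).trans ?_
  refine (meas_ge_le_lintegral_div hFm.aemeasurable (by simp [Real.exp_pos])
    ENNReal.ofReal_ne_top).trans ?_
  refine (ENNReal.div_le_div_right hsym _).trans ?_
  rw [← ENNReal.ofReal_div_of_pos (Real.exp_pos _)]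
  refine ENNReal.ofReal_le_ofReal ?_
  rw [mul_div_assoc, ← Real.exp_sub]
  refine le_of_eq ?_
  congr 2
  rw [hl]
  field_simp
  ring

end Symmetrization

/-! ### Separation of random points on the sphere -/

lemma isProbabilityMeasure_unifSphere {d : ℕ} (hd : 2 ≤ d) :
    IsProbabilityMeasure (unifSphere d) := by
  have : Nontrivial (Fin d) := Fin.nontrivial_iff_two_le.2 hd
  have h0 : (volume : Measure (EuclideanSpace ℝ (Fin d))).toSphere univ ≠ 0 := by
    rw [Measure.measure_univ_ne_zero]
    exact Measure.toSphere_ne_zero _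
  exact ⟨by
    rw [unifSphere, Measure.smul_apply, smul_eq_mul]
    exact ENNReal.inv_mul_cancel h0 (measure_ne_top _ _)⟩

lemma isProbabilityMeasure_unifX {d : ℕ} (hd : 2 ≤ d) : IsProbabilityMeasure (unifX d) := by
  have := isProbabilityMeasure_unifSphere hd
  unfold unifX
  infer_instance

open scoped Pointwise in
/-- The cone over a cap is covered by a ball and a scaled copy of itself, which bounds the volume
of the cone in terms of that of the ball. -/
lemma unifSphere_ball_le {d : ℕ} (hd : 2 ≤ d) (u₀ : Sph d) {η : ℝ} (hη0 : 0 < η) (hη1 : η < 1) :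
    unifSphere d (Metric.ball u₀ η) ≤ ENNReal.ofReal (2 ^ d * η ^ (d - 1)) := by
  have : Nontrivial (Fin d) := Fin.nontrivial_iff_two_le.2 hd
  set E := EuclideanSpace ℝ (Fin d)
  set C : Set E := Ioo (0 : ℝ) 1 • ((↑) '' (Metric.ball u₀ η) : Set E) with hC
  have hfr : Module.finrank ℝ E = d := by simp [E]
  have hVt : volume (Metric.ball (0 : E) 1) ≠ ∞ := measure_ball_lt_top.ne
  have hCsub : C ⊆ Metric.ball (0 : E) 1 := by
    rintro _ ⟨r, hr, _, ⟨u, -, rfl⟩, rfl⟩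
    rw [mem_ball_zero_iff]
    simp only [norm_smul, norm_eq_of_mem_sphere, Real.norm_eq_abs, mul_one]
    rw [abs_of_pos hr.1]
    exact hr.2
  have hCt : volume C ≠ ∞ := ne_top_of_le_ne_top hVt (measure_mono hCsub)
  have hcover : C ⊆ Metric.ball (u₀ : E) (2 * η) ∪ (1 - η) • C := by
    rintro _ ⟨r, hr, _, ⟨u, hu, rfl⟩, rfl⟩
    rcases le_or_gt (1 - η) r with h | h
    · left
      have h1 : dist (r • (u : E)) u = 1 - r := by
        have : r • (u : E) - u = (r - 1) • (u : E) := by rw [sub_smul, one_smul]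
        rw [dist_eq_norm, this, norm_smul, norm_eq_of_mem_sphere, mul_one, Real.norm_eq_abs,
          abs_of_neg (by linarith [hr.2])]
        ring
      have h2 : dist (u : E) u₀ < η := hu
      have h3 := dist_triangle (r • (u : E)) u u₀
      rw [Metric.mem_ball]
      change dist (r • (u : E)) u₀ < 2 * η
      linarith
    · right
      refine ⟨(r / (1 - η)) • (u : E), ⟨r / (1 - η), ⟨?_, ?_⟩, u, ⟨u, hu, rfl⟩, rfl⟩, ?_⟩
      · exact div_pos hr.1 (by linarith)
      · exact (div_lt_one (by linarith)).2 h
      · change (1 - η) • (r / (1 - η)) • (u : E) = r • (u : E)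
        rw [smul_smul, mul_div_cancel₀ _ (by linarith)]
  have hball : volume.real (Metric.ball (u₀ : E) (2 * η)) =
      (2 * η) ^ d * volume.real (Metric.ball (0 : E) 1) := by
    rw [measureReal_def, Measure.addHaar_ball _ _ (by positivity), hfr, ENNReal.toReal_mul,
      ENNReal.toReal_ofReal (by positivity), measureReal_def]
  have hscale : volume.real ((1 - η) • C) = (1 - η) ^ d * volume.real C := by
    rw [measureReal_def, Measure.addHaar_smul, hfr, ENNReal.toReal_mul,
      ENNReal.toReal_ofReal (by positivity), measureReal_def,
      abs_of_nonneg (pow_nonneg (by linarith) _)]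
  have hmain : η * volume.real C ≤ (2 * η) ^ d * volume.real (Metric.ball (0 : E) 1) := by
    have hs : volume ((1 - η) • C) ≠ ∞ := by
      rw [Measure.addHaar_smul]
      exact ENNReal.mul_ne_top ENNReal.ofReal_ne_top hCt
    have h1 : volume.real C ≤
        volume.real (Metric.ball (u₀ : E) (2 * η)) + volume.real ((1 - η) • C) :=
      (measureReal_mono hcover (measure_union_ne_top measure_ball_lt_top.ne hs)).trans
        (measureReal_union_le _ _)
    rw [hball, hscale] at h1
    have h2 : (1 - η) ^ d ≤ 1 - η := pow_le_of_le_one (by linarith) (by linarith) (by omega)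
    have h3 : 0 ≤ volume.real C := measureReal_nonneg
    nlinarith
  have hd0 : (d : ℝ≥0∞) ≠ 0 := by
    simp only [ne_eq, Nat.cast_eq_zero]
    omega
  have heq : unifSphere d (Metric.ball u₀ η) = volume C / volume (Metric.ball (0 : E) 1) := by
    rw [unifSphere, Measure.smul_apply, smul_eq_mul,
      Measure.toSphere_apply' _ Metric.isOpen_ball.measurableSet, Measure.toSphere_apply_univ,
      hfr, mul_comm, ← div_eq_mul_inv]
    exact ENNReal.mul_div_mul_left _ _ hd0 (ENNReal.natCast_ne_top d)
  rw [heq]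
  refine ENNReal.div_le_of_le_mul ?_
  rw [← ENNReal.ofReal_toReal hCt, ← ENNReal.ofReal_toReal hVt,
    ← ENNReal.ofReal_mul (by positivity)]
  refine ENNReal.ofReal_le_ofReal ?_
  change volume.real C ≤ 2 ^ d * η ^ (d - 1) * volume.real (Metric.ball (0 : E) 1)
  have hpow : η ^ d = η * η ^ (d - 1) := by
    rw [← pow_succ']
    congr 1
    omega
  rw [mul_pow, hpow] at hmain
  refine le_of_mul_le_mul_left ?_ hη0
  linarith

lemma measurableSet_dist_fst_lt {d n : ℕ} (i j : Fin n) (η : ℝ) :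
    MeasurableSet {S : Fin n → X d | dist (S i).1 (S j).1 < η} :=
  measurableSet_lt (by fun_prop) measurable_const

lemma measure_dist_fst_lt_le {d n : ℕ} (hd : 2 ≤ d) {i j : Fin n} (hij : i ≠ j) {η : ℝ}
    (hη0 : 0 < η) (hη1 : η < 1) :
    (Measure.pi fun _ : Fin n => unifX d) {S | dist (S i).1 (S j).1 < η} ≤
      ENNReal.ofReal (2 ^ d * η ^ (d - 1)) := by
  have := isProbabilityMeasure_unifSphere hd
  have := isProbabilityMeasure_unifX hd
  have hproj : ∀ k : Fin n, MeasurePreserving (fun S : Fin n → X d => (S k).1)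
      (Measure.pi fun _ : Fin n => unifX d) (unifSphere d) := fun k =>
    measurePreserving_fst.comp (measurePreserving_eval (fun _ : Fin n => unifX d) k)
  have hind : ProbabilityTheory.iIndepFun (fun (k : Fin n) (S : Fin n → X d) => (S k).1)
      (Measure.pi fun _ : Fin n => unifX d) :=
    ProbabilityTheory.iIndepFun_pi (X := fun _ (x : X d) => x.1) fun _ =>
      measurable_fst.aemeasurable
  have hmap := (ProbabilityTheory.indepFun_iff_map_prod_eq_prod_map_map
    (hproj i).measurable.aemeasurable (hproj j).measurable.aemeasurable).1 (hind.indepFun hij)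
  rw [(hproj i).map_eq, (hproj j).map_eq] at hmap
  have hms : MeasurableSet {p : Sph d × Sph d | dist p.1 p.2 < η} :=
    measurableSet_lt (by fun_prop) measurable_const
  have h1 : (Measure.pi fun _ : Fin n => unifX d) {S | dist (S i).1 (S j).1 < η} =
      ((unifSphere d).prod (unifSphere d)) {p | dist p.1 p.2 < η} := by
    rw [← hmap, Measure.map_apply (by fun_prop) hms]
    rfl
  rw [h1, Measure.prod_apply hms]
  calc ∫⁻ u, unifSphere d (Prod.mk u ⁻¹' {p | dist p.1 p.2 < η}) ∂(unifSphere d)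
      ≤ ∫⁻ _u, ENNReal.ofReal (2 ^ d * η ^ (d - 1)) ∂(unifSphere d) := by
        refine lintegral_mono fun u => ?_
        have : Prod.mk u ⁻¹' {p : Sph d × Sph d | dist p.1 p.2 < η} = Metric.ball u η := by
          ext v
          simp [dist_comm]
        rw [this]
        exact unifSphere_ball_le hd u hη0 hη1
    _ = _ := by simp

/-- With probability at least `1 / 2`, the first components of `n` uniform points are pairwise at
distance at least `n ^ (-2 / (d - 1)) / 8`. -/
lemma measure_not_separated_le {d n : ℕ} (hd : 2 ≤ d) (hn : 1 ≤ n) :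
    (Measure.pi fun _ : Fin n => unifX d)
        {S | ∃ i j, i ≠ j ∧ dist (S i).1 (S j).1 < (n : ℝ) ^ (-2 / ((d : ℝ) - 1)) / 8} ≤ 2⁻¹ := by
  set η : ℝ := (n : ℝ) ^ (-2 / ((d : ℝ) - 1)) / 8 with hη
  have hn' : (1 : ℝ) ≤ n := by exact_mod_cast hn
  have hd' : (2 : ℝ) ≤ d := by exact_mod_cast hd
  have hη0 : 0 < η := by positivity
  have hη1 : η < 1 := by
    have : (n : ℝ) ^ (-2 / ((d : ℝ) - 1)) ≤ 1 :=
      Real.rpow_le_one_of_one_le_of_nonpos hn'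
        (div_nonpos_of_nonpos_of_nonneg (by norm_num) (by linarith))
    rw [hη]
    linarith
  have hbound : (2 : ℝ) ^ d * η ^ (d - 1) ≤ 2⁻¹ * ((n : ℝ) ^ 2)⁻¹ := by
    obtain ⟨k, rfl⟩ : ∃ k, d = k + 2 := ⟨d - 2, by omega⟩
    have e1 : ((n : ℝ) ^ (-2 / (((k + 2 : ℕ) : ℝ) - 1))) ^ (k + 1) = ((n : ℝ) ^ 2)⁻¹ := by
      rw [← Real.rpow_natCast, ← Real.rpow_mul (by positivity)]
      have : -2 / (((k + 2 : ℕ) : ℝ) - 1) * ((k + 1 : ℕ) : ℝ) = -2 := by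
        push_cast
        have : (k : ℝ) + 2 - 1 ≠ 0 := by
          have : (0 : ℝ) ≤ k := k.cast_nonneg
          linarith
        field_simp
        ring
      rw [this, Real.rpow_neg (by positivity)]
      norm_cast
    rw [show k + 2 - 1 = k + 1 by omega, hη, div_pow, e1]
    have e2 : (8 : ℝ) ^ (k + 1) = 4 ^ (k + 1) * 2 ^ (k + 1) := by rw [← mul_pow]; norm_num
    have e3 : (4 : ℝ) ≤ 4 ^ (k + 1) := le_self_pow₀ (by norm_num) (by omega)
    have e4 : (2 : ℝ) ^ (k + 2) = 2 * 2 ^ (k + 1) := by ring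
    rw [e2, e4]
    have hi : 0 < ((n : ℝ) ^ 2)⁻¹ := by positivity
    have h2 : (0 : ℝ) < 2 ^ (k + 1) := by positivity
    rw [mul_div_assoc', div_le_iff₀ (by positivity)]
    nlinarith [mul_pos hi h2]
  have hsub : {S : Fin n → X d | ∃ i j, i ≠ j ∧ dist (S i).1 (S j).1 < η} ⊆
      ⋃ p ∈ (Finset.univ : Finset (Fin n × Fin n)),
        {S : Fin n → X d | p.1 ≠ p.2 ∧ dist (S p.1).1 (S p.2).1 < η} := by
    rintro S ⟨i, j, h⟩
    simp only [mem_iUnion]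
    exact ⟨(i, j), Finset.mem_univ _, h⟩
  refine (measure_mono hsub).trans ((measure_biUnion_finset_le _ _).trans ?_)
  have hterm : ∀ p : Fin n × Fin n, (Measure.pi fun _ : Fin n => unifX d)
      {S : Fin n → X d | p.1 ≠ p.2 ∧ dist (S p.1).1 (S p.2).1 < η} ≤
        ENNReal.ofReal (2⁻¹ * ((n : ℝ) ^ 2)⁻¹) := by
    rintro ⟨i, j⟩
    by_cases hij : i = j
    · simp [hij]
    · simp only [ne_eq, hij, not_false_eq_true, true_and]
      exact (measure_dist_fst_lt_le hd hij hη0 hη1).trans (ENNReal.ofReal_le_ofReal hbound)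
  refine (Finset.sum_le_card_nsmul _ _ _ fun p _ => hterm p).trans ?_
  rw [Finset.card_univ, Fintype.card_prod, Fintype.card_fin, nsmul_eq_mul,
    show ((n * n : ℕ) : ℝ≥0∞) = ENNReal.ofReal ((n : ℝ) ^ 2) by
      rw [← ENNReal.ofReal_natCast]; push_cast; rw [sq],
    ← ENNReal.ofReal_mul (by positivity)]
  rw [show (n : ℝ) ^ 2 * (2⁻¹ * ((n : ℝ) ^ 2)⁻¹) = 2⁻¹ by field_simp,
    ENNReal.ofReal_inv_of_pos (by norm_num)]
  simp

lemma measurableSet_not_separated {d n : ℕ} (η : ℝ) :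
    MeasurableSet {S : Fin n → X d | ∃ i j, i ≠ j ∧ dist (S i).1 (S j).1 < η} := by
  have : {S : Fin n → X d | ∃ i j, i ≠ j ∧ dist (S i).1 (S j).1 < η} =
      ⋃ i, ⋃ j, ⋃ _ : i ≠ j, {S : Fin n → X d | dist (S i).1 (S j).1 < η} := by
    ext S
    simp
  rw [this]
  exact MeasurableSet.iUnion fun i => MeasurableSet.iUnion fun j => MeasurableSet.iUnion fun _ =>
    measurableSet_dist_fst_lt i j η

/-! ### Norm-bounded networks -/

lemma Net.continuous_eval : ∀ {n L : ℕ} (φ : Net n L), Continuous φ.eval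
  | _, _, .output w b => by
      simp only [Net.eval, dotProduct]
      fun_prop
  | _, _, .layer W b rest => by
      have h := rest.continuous_eval
      simp only [Net.eval]
      refine h.comp (continuous_pi fun i => ?_)
      simp only [Matrix.mulVec, dotProduct]
      fun_prop

lemma continuous_toVec {d : ℕ} : Continuous (toVec : X d → Fin (d + d) → ℝ) := by
  refine continuous_pi fun i => ?_
  refine Fin.addCases (fun i => ?_) (fun i => ?_) i
  · simp only [toVec, Fin.append_left]
    fun_prop
  · simp only [toVec, Fin.append_right]
    fun_prop

lemma Net.continuous_realize {d L : ℕ} (φ : Net (d + d) L) : Continuous φ.realize :=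
  φ.continuous_eval.comp continuous_toVec

lemma Net.normSq_nonneg : ∀ {n L : ℕ} (φ : Net n L), 0 ≤ φ.normSq
  | _, _, .output w b => by simp only [Net.normSq]; positivity
  | _, _, .layer W b rest => by
      have h := rest.normSq_nonneg
      simp only [Net.normSq]
      positivity

lemma sum_sq_sphere {d : ℕ} (u : Sph d) : ∑ i, u.1 i ^ 2 = 1 := by
  have h := EuclideanSpace.norm_sq_eq u.1
  rw [norm_eq_of_mem_sphere] at h
  simpa using h.symm

lemma sum_sq_toVec {d : ℕ} (x : X d) : ∑ i, toVec x i ^ 2 = 2 := by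
  rw [Fin.sum_univ_add]
  simp only [toVec, Fin.append_left, Fin.append_right, sum_sq_sphere]
  norm_num

/-- The affine functions whose coefficient vector, including the constant term, has Euclidean norm
at most one. -/
def unitAffine (d : ℕ) : Set (X d → ℝ) :=
  {g | ∃ (w : Fin (d + d) → ℝ) (b : ℝ), (∑ i, w i ^ 2) + b ^ 2 ≤ 1 ∧
    ∀ x, g x = w ⬝ᵥ toVec x + b}

lemma one_mem_unitAffine (d : ℕ) : (fun _ => 1) ∈ unitAffine d :=
  ⟨0, 1, by simp, by simp⟩

/-- The vector of all entries of a point and the constant one. -/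
def liftVec {d : ℕ} (x : X d) : EuclideanSpace ℝ (Fin (d + d) ⊕ Unit) :=
  WithLp.toLp 2 (Sum.elim (toVec x) fun _ => 1)

lemma norm_liftVec {d : ℕ} (x : X d) : ‖liftVec x‖ = √3 := by
  rw [EuclideanSpace.norm_eq]
  congr 1
  rw [Fintype.sum_sum_type]
  simp only [liftVec, Sum.elim_inl, Sum.elim_inr, Real.norm_eq_abs, sq_abs, sum_sq_toVec]
  norm_num

lemma exists_inner_of_mem_unitAffine {d : ℕ} {g : X d → ℝ} (hg : g ∈ unitAffine d) :
    ∃ w : EuclideanSpace ℝ (Fin (d + d) ⊕ Unit), ‖w‖ ≤ 1 ∧ ∀ x, g x = inner ℝ w (liftVec x) := by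
  obtain ⟨w, b, h, hg⟩ := hg
  refine ⟨WithLp.toLp 2 (Sum.elim w fun _ => b), ?_, fun x => ?_⟩
  · rw [EuclideanSpace.norm_eq, Real.sqrt_le_one]
    rw [Fintype.sum_sum_type]
    simpa using h
  · rw [hg, PiLp.inner_apply, Fintype.sum_sum_type]
    simp [liftVec, dotProduct, mul_comm]

lemma abs_le_of_mem_unitAffine {d : ℕ} {g : X d → ℝ} (hg : g ∈ unitAffine d) (x : X d) :
    |g x| ≤ √3 := by
  obtain ⟨w, hw, h⟩ := exists_inner_of_mem_unitAffine hg
  rw [h, ← norm_liftVec x]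
  exact (abs_real_inner_le_norm _ _).trans (mul_le_of_le_one_left (norm_nonneg _) hw)

lemma signSup_unitAffine_le {d m : ℕ} (S : Fin m → X d) (s : ℝ) :
    signSup (fun (a : unitAffine d) i => s * a.1 (S i)) ≤
      2 ^ m * ENNReal.ofReal (2 * Real.exp (m * (3 / 2 * s ^ 2))) := by
  have h := signSup_inner_le (fun i => s • liftVec (S i)) (K := |s| * √3)
    (fun i => by rw [norm_smul, norm_liftVec, Real.norm_eq_abs])
    (T := fun (a : unitAffine d) i => s * a.1 (S i)) (fun a => by
      obtain ⟨w, hw, h⟩ := exists_inner_of_mem_unitAffine a.2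
      exact ⟨w, hw, fun i => by rw [inner_smul_right, h]⟩)
  rw [mul_pow, sq_abs, Real.sq_sqrt (by norm_num), Fintype.card_fin] at h
  convert h using 5
  ring

/-- A layer of ReLU units whose preactivations are multiples `ρ j • a j` of functions in `A`.
The bias of the next layer is the multiple of a ReLU unit with constant preactivation one. -/
lemma layer_mem_reluHull {Y : Type*} {A : Set (Y → ℝ)} (h1 : (fun _ => 1) ∈ A) {k : ℕ}
    {ρ : Fin k → ℝ} {a : Fin k → Y → ℝ} (hρ : ∀ j, 0 ≤ ρ j) (ha : ∀ j, a j ∈ A) {M N : ℝ}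
    (hM : ∑ j, ρ j ^ 2 ≤ M) (hN : 0 ≤ N) (w : Fin k → ℝ) (b : ℝ)
    (hw : (∑ j, w j ^ 2) + b ^ 2 ≤ N ^ 2) :
    (fun y => ∑ j, w j * max (ρ j * a j y) 0 + b) ∈ reluHull (N * (√M + 1)) A := by
  refine ⟨k + 1, Fin.cons b fun j => w j * ρ j, Fin.cons (fun _ => 1) a, ?_, ?_, fun y => ?_⟩
  · refine Fin.cases ?_ fun j => ?_
    · simpa using h1
    · simpa using ha j
  · rw [Fin.sum_univ_succ]
    simp only [Fin.cons_zero, Fin.cons_succ, abs_mul]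
    have hb : |b| ≤ N := by
      refine abs_le_of_sq_le_sq ?_ hN
      have : 0 ≤ ∑ j, w j ^ 2 := Finset.sum_nonneg fun _ _ => sq_nonneg _
      linarith
    have hs : ∑ j, |w j| * |ρ j| ≤ N * √M := by
      refine (Real.sum_mul_le_sqrt_mul_sqrt _ _ _).trans ?_
      simp only [sq_abs]
      refine mul_le_mul ?_ (Real.sqrt_le_sqrt hM) (Real.sqrt_nonneg _) hN
      refine Real.sqrt_le_iff.2 ⟨hN, ?_⟩
      linarith [sq_nonneg b]
    linarith
  · rw [Fin.sum_univ_succ, add_comm]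
    simp only [Fin.cons_zero, Fin.cons_succ]
    refine congrArg₂ _ (Finset.sum_congr rfl fun j _ => ?_) (by simp)
    rw [mul_assoc, mul_max_of_nonneg _ _ (hρ j), mul_zero]

/-- Homogeneity: the coefficient vector of the next layer is normalized. -/
lemma exists_layer_eq_smul {Y : Type*} {A : Set (Y → ℝ)} (h1 : (fun _ => 1) ∈ A) {k : ℕ}
    {ρ : Fin k → ℝ} {a : Fin k → Y → ℝ} (hρ : ∀ j, 0 ≤ ρ j) (ha : ∀ j, a j ∈ A) {M : ℝ}
    (hM : ∑ j, ρ j ^ 2 ≤ M) (w : Fin k → ℝ) (b : ℝ) :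
    ∃ h ∈ reluHull (√M + 1) A, ∀ y, ∑ j, w j * max (ρ j * a j y) 0 + b =
      √((∑ j, w j ^ 2) + b ^ 2) * h y := by
  set r := √((∑ j, w j ^ 2) + b ^ 2) with hr
  have hnn : 0 ≤ (∑ j, w j ^ 2) + b ^ 2 := by positivity
  have hr2 : r ^ 2 = (∑ j, w j ^ 2) + b ^ 2 := Real.sq_sqrt hnn
  have hle : (∑ j, (w j / r) ^ 2) + (b / r) ^ 2 ≤ 1 ^ 2 := by
    simp only [div_pow]
    rw [← Finset.sum_div, ← add_div, ← hr2, one_pow]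
    exact div_self_le_one _
  have hmem := layer_mem_reluHull h1 hρ ha hM zero_le_one (fun j => w j / r) (b / r) hle
  rw [one_mul] at hmem
  refine ⟨_, hmem, fun y => ?_⟩
  rcases eq_or_ne r 0 with h0 | h0
  · rw [h0, zero_pow (by norm_num)] at hr2
    have hw : ∀ j, w j = 0 := by
      have h2 : ∑ j, w j ^ 2 = 0 := by
        have : 0 ≤ ∑ j, w j ^ 2 := Finset.sum_nonneg fun _ _ => sq_nonneg _
        linarith [sq_nonneg b]
      intro j
      have := (Finset.sum_eq_zero_iff_of_nonneg fun _ _ => sq_nonneg _).1 h2 j (Finset.mem_univ j)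
      simpa using this
    have hb : b = 0 := by
      have : 0 ≤ ∑ j, w j ^ 2 := Finset.sum_nonneg fun _ _ => sq_nonneg _
      have : b ^ 2 = 0 := le_antisymm (by linarith) (sq_nonneg b)
      simpa using this
    simp [hw, hb, h0]
  · rw [mul_add, Finset.mul_sum, mul_div_cancel₀ _ h0]
    congr 1
    refine Finset.sum_congr rfl fun j _ => ?_
    rw [← mul_assoc, mul_div_cancel₀ _ h0]

lemma exists_affine_eq_smul {d : ℕ} (w : Fin (d + d) → ℝ) (b : ℝ) :
    ∃ a ∈ unitAffine d, ∀ x, w ⬝ᵥ toVec x + b = √((∑ j, w j ^ 2) + b ^ 2) * a x := by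
  set r := √((∑ j, w j ^ 2) + b ^ 2) with hr
  have hnn : 0 ≤ (∑ j, w j ^ 2) + b ^ 2 := by positivity
  have hr2 : r ^ 2 = (∑ j, w j ^ 2) + b ^ 2 := Real.sq_sqrt hnn
  refine ⟨fun x => (r⁻¹ • w) ⬝ᵥ toVec x + r⁻¹ * b, ⟨_, _, ?_, fun _ => rfl⟩, fun x => ?_⟩
  · simp only [Pi.smul_apply, smul_eq_mul, mul_pow]
    rw [← Finset.mul_sum, ← mul_add, ← hr2, ← mul_pow]
    exact pow_le_one₀ (by positivity) inv_mul_le_one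
  · change _ = r * ((r⁻¹ • w) ⬝ᵥ toVec x + r⁻¹ * b)
    rw [smul_dotProduct, smul_eq_mul, ← mul_add, ← mul_assoc]
    rcases eq_or_ne r 0 with h0 | h0
    · rw [h0, zero_pow (by norm_num)] at hr2
      have hs : 0 ≤ ∑ j, w j ^ 2 := Finset.sum_nonneg fun _ _ => sq_nonneg _
      have h2 : ∑ j, w j ^ 2 = 0 := by linarith [sq_nonneg b]
      have hw : w = 0 := by
        funext j
        have := (Finset.sum_eq_zero_iff_of_nonneg fun _ _ => sq_nonneg _).1 h2 j (Finset.mem_univ j)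
        simpa using this
      have hb : b = 0 := by
        have : b ^ 2 = 0 := le_antisymm (by linarith) (sq_nonneg b)
        simpa using this
      simp [hw, hb]
    · rw [mul_inv_cancel₀ h0, one_mul]

/-- The class that contains all depth-3 networks with squared parameter norm at most `M`. -/
def hullThree (d : ℕ) (M : ℝ) : Set (X d → ℝ) :=
  reluHull (√M * (√M + 1)) (reluHull (√M + 1) (unitAffine d))

lemma one_mem_reluHull_unitAffine (d : ℕ) (M : ℝ) :
    (fun _ => 1) ∈ reluHull (√M + 1) (unitAffine d) :=
  ⟨1, fun _ => 1, fun _ _ => 1, fun _ => one_mem_unitAffine d, by simp, by simp⟩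

lemma Net.realize_mem_hullThree {d : ℕ} {M : ℝ} (φ : Net (d + d) 3) (h : φ.normSq ≤ M) :
    φ.realize ∈ hullThree d M := by
  match φ, h with
  | .layer W b (.layer V c (.output w e)), h =>
    simp only [Net.normSq] at h
    have n1 : 0 ≤ ∑ i, ∑ j, W i j ^ 2 :=
      Finset.sum_nonneg fun _ _ => Finset.sum_nonneg fun _ _ => sq_nonneg _
    have n2 : 0 ≤ ∑ i, ∑ j, V i j ^ 2 :=
      Finset.sum_nonneg fun _ _ => Finset.sum_nonneg fun _ _ => sq_nonneg _
    have n3 : 0 ≤ ∑ i, b i ^ 2 := Finset.sum_nonneg fun _ _ => sq_nonneg _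
    have n4 : 0 ≤ ∑ i, c i ^ 2 := Finset.sum_nonneg fun _ _ => sq_nonneg _
    have n5 : 0 ≤ ∑ i, w i ^ 2 := Finset.sum_nonneg fun _ _ => sq_nonneg _
    have n6 := sq_nonneg e
    have hM : 0 ≤ M := by linarith
    choose a ha hae using fun i => exists_affine_eq_smul (d := d) (W i) (b i)
    have hsq : ∀ {k l : ℕ} (U : Matrix (Fin k) (Fin l) ℝ) (v : Fin k → ℝ),
        ∑ i, √((∑ j, U i j ^ 2) + v i ^ 2) ^ 2 = (∑ i, ∑ j, U i j ^ 2) + ∑ i, v i ^ 2 := by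
      intro k l U v
      rw [← Finset.sum_add_distrib]
      exact Finset.sum_congr rfl fun i _ => Real.sq_sqrt (by positivity)
    have hρ1 : ∑ i, √((∑ j, W i j ^ 2) + b i ^ 2) ^ 2 ≤ M := by rw [hsq]; linarith
    choose g hg hge using fun k => exists_layer_eq_smul (one_mem_unitAffine d)
      (fun i => Real.sqrt_nonneg ((∑ j, W i j ^ 2) + b i ^ 2)) ha hρ1 (V k) (c k)
    have hρ2 : ∑ i, √((∑ j, V i j ^ 2) + c i ^ 2) ^ 2 ≤ M := by rw [hsq]; linarith
    have key := layer_mem_reluHull (one_mem_reluHull_unitAffine d M)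
      (fun i => Real.sqrt_nonneg ((∑ j, V i j ^ 2) + c i ^ 2)) hg hρ2 (Real.sqrt_nonneg M) w e
      (by rw [Real.sq_sqrt hM]; linarith)
    refine (congrArg (· ∈ hullThree d M) (funext fun x => ?_)).mpr key
    simp only [Net.realize, Net.eval, dotProduct]
    congr 1
    refine Finset.sum_congr rfl fun k _ => ?_
    rw [← hge]
    simp only [Matrix.mulVec, dotProduct, ← hae]

/-- Any depth-2 network is a depth-3 network: the first layer computes the positive and the
negative parts of the inputs. -/
lemma Net.exists_depth_three {n : ℕ} (φ : Net n 2) :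
    ∃ ψ : Net n 3, ψ.eval = φ.eval ∧ ψ.normSq ≤ 2 * n + 2 * φ.normSq := by
  match φ with
  | .layer W b (.output w c) =>
    refine ⟨.layer (k := n + n) (Fin.append (fun i => Pi.single i 1) fun i => Pi.single i (-1)) 0
      (.layer (fun k => Fin.append (W k) (-W k)) b (.output w c)), ?_, ?_⟩
    · funext x
      simp only [Net.eval]
      congr 2
      funext k
      congr 2
      simp only [Matrix.mulVec, dotProduct]
      rw [Fin.sum_univ_add, ← Finset.sum_add_distrib]
      refine Finset.sum_congr rfl fun j _ => ?_
      have e1 : ∑ i, (Pi.single j 1 : Fin n → ℝ) i * x i = x j := by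
        simp [Pi.single_apply]
      have e2 : ∑ i, (Pi.single j (-1) : Fin n → ℝ) i * x i = -x j := by
        simp [Pi.single_apply]
      simp only [Fin.append_left, Fin.append_right, e1, e2, Pi.neg_apply, Pi.zero_apply, add_zero]
      rcases le_total 0 (x j) with h | h
      · rw [max_eq_left h, max_eq_right (by linarith)]
        ring
      · rw [max_eq_right h, max_eq_left (by linarith)]
        ring
    · simp only [Net.normSq]
      have e1 : ∀ (j : Fin n) (t : ℝ), ∑ i, (Pi.single j t : Fin n → ℝ) i ^ 2 = t ^ 2 := by
        intro j t
        simp [Pi.single_apply, ite_pow]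
      rw [Fin.sum_univ_add]
      simp only [Fin.append_left, Fin.append_right, e1, Fin.sum_univ_add, Pi.neg_apply, neg_sq,
        Finset.sum_add_distrib, Pi.zero_apply]
      have n3 : 0 ≤ ∑ i, b i ^ 2 := Finset.sum_nonneg fun _ _ => sq_nonneg _
      have n5 : 0 ≤ ∑ i, w i ^ 2 := Finset.sum_nonneg fun _ _ => sq_nonneg _
      have n6 := sq_nonneg c
      simp
      linarith

/-- Interpolation by ridge functions: when the points `x i` of the first sphere are separated by
`η`, the cap `⟪x i, ·⟫ > 1 - η ^ 2 / 2` contains no other point. -/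
lemma exists_interpolant {d n : ℕ} (x : Fin n → X d) (y : Fin n → ℝ) (hy : ∀ i, |y i| ≤ 1) {η : ℝ}
    (hη0 : 0 < η) (hη1 : η ≤ 1) (hsep : ∀ i j, i ≠ j → η ≤ dist (x i).1 (x j).1) :
    ∃ φ : Net (d + d) 2, (∀ i, φ.realize (x i) = y i) ∧ φ.normSq ≤ 6 * n / η ^ 2 := by
  set s : ℝ := √2 / η with hs
  have hs2 : s ^ 2 = 2 / η ^ 2 := by rw [hs, div_pow, Real.sq_sqrt (by norm_num)]
  refine ⟨.layer (k := n) (fun i => Fin.append (fun j => s * (x i).1.1 j) fun _ => 0)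
    (fun _ => -(s * (1 - η ^ 2 / 2))) (.output (fun i => y i * s) 0), fun j => ?_, ?_⟩
  · simp only [Net.realize, Net.eval, dotProduct, Matrix.mulVec, add_zero]
    have hpre : ∀ i, ∑ k, Fin.append (fun j => s * (x i).1.1 j) (fun _ => 0) k * toVec (x j) k +
        -(s * (1 - η ^ 2 / 2)) = s * (η ^ 2 / 2 - dist (x i).1 (x j).1 ^ 2 / 2) := by
      intro i
      rw [Fin.sum_univ_add]
      simp only [toVec, Fin.append_left, Fin.append_right, zero_mul, Finset.sum_const_zero,
        add_zero]
      have hd : dist (x i).1 (x j).1 ^ 2 = 2 - 2 * ∑ k, (x i).1.1 k * (x j).1.1 k := by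
        rw [Subtype.dist_eq, EuclideanSpace.dist_eq, Real.sq_sqrt (by positivity)]
        have : ∀ k, dist ((x i).1.1 k) ((x j).1.1 k) ^ 2 =
            (x i).1.1 k ^ 2 + (x j).1.1 k ^ 2 - 2 * ((x i).1.1 k * (x j).1.1 k) := by
          intro k
          rw [Real.dist_eq, sq_abs]
          ring
        simp only [this, Finset.sum_sub_distrib, Finset.sum_add_distrib, sum_sq_sphere,
          ← Finset.mul_sum]
        norm_num
      simp only [mul_assoc, ← Finset.mul_sum]
      rw [hd]
      ring
    simp only [hpre]
    rw [Finset.sum_eq_single j]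
    · rw [dist_self, max_eq_left (by ring_nf; positivity)]
      rw [show y j * s * (s * (η ^ 2 / 2 - 0 ^ 2 / 2)) = y j * (s ^ 2 * (η ^ 2 / 2)) by ring, hs2]
      field_simp
    · intro i _ hij
      have h1 := hsep i j hij
      have h2 : η ^ 2 ≤ dist (x i).1 (x j).1 ^ 2 := pow_le_pow_left₀ hη0.le h1 2
      have hs0 : 0 ≤ s := by positivity
      rw [max_eq_right, mul_zero]
      exact mul_nonpos_of_nonneg_of_nonpos hs0 (by linarith)
    · simp
  · simp only [Net.normSq, Fin.sum_univ_add, Fin.append_left, Fin.append_right, mul_pow,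
      ← Finset.mul_sum, sum_sq_sphere]
    have hb : (1 - η ^ 2 / 2) ^ 2 ≤ 1 := by
      have : η ^ 2 ≤ 1 := pow_le_one₀ hη0.le hη1
      refine pow_le_one₀ (by linarith) ?_
      linarith [sq_nonneg η]
    have hyy : ∑ i, y i ^ 2 * s ^ 2 ≤ n * s ^ 2 := by
      rw [← Finset.sum_mul]
      refine mul_le_mul_of_nonneg_right ?_ (sq_nonneg s)
      calc ∑ i, y i ^ 2 ≤ ∑ _i : Fin n, (1 : ℝ) :=
            Finset.sum_le_sum fun i _ => (sq_le_one_iff_abs_le_one _).2 (hy i)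
        _ = n := by simp
    have hbb : s ^ 2 * (1 - η ^ 2 / 2) ^ 2 ≤ s ^ 2 := mul_le_of_le_one_right (sq_nonneg s) hb
    have hn : (0 : ℝ) ≤ n := n.cast_nonneg
    have e : 6 * (n : ℝ) / η ^ 2 = n * s ^ 2 + n * s ^ 2 + n * s ^ 2 := by rw [hs2]; ring
    rw [e]
    have := mul_le_mul_of_nonneg_left hbb hn
    simp [mul_pow]
    linarith

/-! ### Representation costs -/

lemma repCost_realize_le {d L : ℕ} (φ : Net (d + d) L) :
    repCost d L φ.realize ≤ ENNReal.ofReal (φ.normSq / L) :=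
  iInf₂_le (f := fun (ψ : Net (d + d) L) (_ : ψ.realize = φ.realize) =>
    ENNReal.ofReal (ψ.normSq / L)) φ rfl

lemma exists_net_of_repCost_le {d L : ℕ} (hL : 0 < L) {g : X d → ℝ} {r : ℝ} (hr : 0 ≤ r)
    (h : repCost d L g ≤ ENNReal.ofReal (r / L)) :
    ∃ φ : Net (d + d) L, φ.realize = g ∧ φ.normSq ≤ r + 1 := by
  have hL' : (0 : ℝ) < L := by exact_mod_cast hL
  have hlt : repCost d L g < ENNReal.ofReal ((r + 1) / L) := by
    refine h.trans_lt ((ENNReal.ofReal_lt_ofReal_iff (by positivity)).2 ?_)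
    gcongr
    linarith
  unfold repCost at hlt
  simp only [iInf_lt_iff] at hlt
  obtain ⟨φ, hφ, hlt⟩ := hlt
  refine ⟨φ, hφ, ?_⟩
  have := (ENNReal.ofReal_lt_ofReal_iff (by positivity)).1 hlt
  exact ((div_lt_div_iff_of_pos_right hL').1 this).le

/-! ### Uniform convergence of the squared loss over depth-3 networks -/

/-- A bound on the exponential moments of the Rademacher sums of the squared losses. The term
`f ^ 2` of the loss is split off because the contraction principle applies to functions of the
network output that vanish at zero. -/
lemma signSup_sqLoss_le {d m : ℕ} {κ : Type*} {M : ℝ} (hM : 1 ≤ M) {f : X d → ℝ}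
    (hf : ∀ x, |f x| ≤ 1) (g : κ → X d → ℝ) (hg : ∀ k, g k ∈ hullThree d M) (S : Fin m → X d)
    {s : ℝ} (hs : 0 ≤ s) :
    signSup (fun k i => s * (g k (S i) - f (S i)) ^ 2) ≤
      2 ^ m * ENNReal.ofReal (8 * Real.exp (m * (24576 * M ^ 6 * s ^ 2))) := by
  obtain ⟨r, hr, rfl⟩ : ∃ r : ℝ, 1 ≤ r ∧ M = r ^ 2 :=
    ⟨√M, by simpa using hM, (Real.sq_sqrt (by linarith)).symm⟩
  have hr0 : 0 ≤ r := by linarith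
  set R₂ := r + 1 with hR2
  set R₃ := r * (r + 1) with hR3
  have hhull : hullThree d (r ^ 2) = reluHull R₃ (reluHull R₂ (unitAffine d)) := by
    rw [hullThree, Real.sqrt_sq hr0]
  have hone : (fun _ => 1) ∈ reluHull R₂ (unitAffine d) := by
    have := one_mem_reluHull_unitAffine d (r ^ 2)
    rwa [Real.sqrt_sq hr0] at this
  have hR3r : R₃ * R₂ ≤ 4 * r ^ 3 := by
    rw [hR2, hR3]
    nlinarith [mul_nonneg hr0 (sub_nonneg.2 hr), mul_nonneg (sq_nonneg r) (sub_nonneg.2 hr)]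
  have hgb : ∀ k x, |g k x| ≤ 7 * r ^ 3 := by
    intro k x
    have hk := hg k
    rw [hhull] at hk
    have h3 : √(3 : ℝ) ≤ 7 / 4 := Real.sqrt_le_iff.2 ⟨by norm_num, by norm_num⟩
    calc |g k x| ≤ R₃ * (R₂ * √3) := abs_le_of_mem_reluHull (by positivity)
          (fun a ha y => abs_le_of_mem_reluHull (Real.sqrt_nonneg 3)
            (fun b hb z => abs_le_of_mem_unitAffine hb z) ha y) hk x
      _ = (R₃ * R₂) * √3 := by ring
      _ ≤ (4 * r ^ 3) * (7 / 4) := mul_le_mul hR3r h3 (Real.sqrt_nonneg _) (by positivity)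
      _ = 7 * r ^ 3 := by ring
  have hr3 : 1 ≤ r ^ 3 := one_le_pow₀ hr
  set t : ℝ := 32 * s * r ^ 3 with ht
  have ht0 : 0 ≤ t := by positivity
  have hsplit : (fun k (i : Fin m) => s * (g k (S i) - f (S i)) ^ 2) =
      fun k i => s * (g k (S i) ^ 2 - 2 * g k (S i) * f (S i)) + s * f (S i) ^ 2 := by
    funext k i
    ring
  have hdiff : ∀ (u v y : ℝ), |u| ≤ 7 * r ^ 3 → |v| ≤ 7 * r ^ 3 → |y| ≤ 1 →
      |2 * (s * (u ^ 2 - 2 * u * y)) - 2 * (s * (v ^ 2 - 2 * v * y))| ≤ |t * u - t * v| := by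
    intro u v y hu hv hy
    rw [← mul_sub t, abs_mul, abs_of_nonneg ht0,
      show 2 * (s * (u ^ 2 - 2 * u * y)) - 2 * (s * (v ^ 2 - 2 * v * y)) =
        (2 * s * (u + v - 2 * y)) * (u - v) by ring, abs_mul]
    refine mul_le_mul_of_nonneg_right ?_ (abs_nonneg _)
    rw [abs_mul, abs_of_nonneg (by positivity : 0 ≤ 2 * s), ht]
    have : |u + v - 2 * y| ≤ 16 * r ^ 3 := by
      rw [abs_le] at hu hv hy ⊢
      constructor <;> linarith
    calc 2 * s * |u + v - 2 * y| ≤ 2 * s * (16 * r ^ 3) := by gcongr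
      _ = 32 * s * r ^ 3 := by ring
  have hA : signSup (fun k i => 2 * (s * (g k (S i) ^ 2 - 2 * g k (S i) * f (S i)))) ≤
      2 ^ m * ENNReal.ofReal (8 * Real.exp (m * (24576 * (r ^ 2) ^ 6 * s ^ 2))) := by
    have c1 : signSup (fun k i => 2 * (s * (g k (S i) ^ 2 - 2 * g k (S i) * f (S i)))) ≤
        signSup (fun k i => t * g k (S i)) := by
      refine signSup_contraction _ _ (fun k i => ?_) fun k l i =>
        hdiff _ _ _ (hgb k _) (hgb l _) (hf _)
      simpa using hdiff (g k (S i)) 0 (f (S i)) (hgb k _) (by simp; positivity) (hf _)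
    have c2 : signSup (fun k i => t * g k (S i)) ≤
        signSup (fun (h : reluHull R₃ (reluHull R₂ (unitAffine d))) i => t * h.1 (S i)) :=
      signSup_mono fun k => ⟨⟨g k, hhull ▸ hg k⟩, rfl⟩
    have c3 := signSup_reluHull_le (R := R₃) ht0 (by positivity) ⟨_, hone⟩ S
    have c4 := signSup_reluHull_le (R := R₂) (t := t * R₃) (by positivity) (by positivity)
      ⟨_, one_mem_unitAffine d⟩ S
    have c5 := signSup_unitAffine_le S (t * R₃ * R₂)
    refine c1.trans (c2.trans (c3.trans ((mul_le_mul_right (c4.trans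
      (mul_le_mul_right c5 2)) 2).trans ?_)))
    rw [mul_left_comm 2 ((2 : ℝ≥0∞) ^ m), mul_left_comm 2 ((2 : ℝ≥0∞) ^ m)]
    refine mul_le_mul_right ?_ _
    rw [show (2 : ℝ≥0∞) = ENNReal.ofReal 2 by norm_num, ← ENNReal.ofReal_mul (by positivity),
      ← ENNReal.ofReal_mul (by positivity)]
    refine ENNReal.ofReal_le_ofReal ?_
    have hsq : (t * R₃ * R₂) ^ 2 ≤ (128 * s * r ^ 6) ^ 2 := by
      refine pow_le_pow_left₀ (by positivity) ?_ 2
      calc t * R₃ * R₂ = t * (R₃ * R₂) := by ring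
        _ ≤ t * (4 * r ^ 3) := by gcongr
        _ = 128 * s * r ^ 6 := by rw [ht]; ring
    have hexp : Real.exp (m * (3 / 2 * (t * R₃ * R₂) ^ 2)) ≤
        Real.exp (m * (24576 * (r ^ 2) ^ 6 * s ^ 2)) := by
      refine Real.exp_le_exp.2 (mul_le_mul_of_nonneg_left ?_ m.cast_nonneg)
      calc 3 / 2 * (t * R₃ * R₂) ^ 2 ≤ 3 / 2 * (128 * s * r ^ 6) ^ 2 := by gcongr
        _ = 24576 * (r ^ 2) ^ 6 * s ^ 2 := by ring
    linarith
  have hB : signSup (fun (_ : κ) (i : Fin m) => 2 * (s * f (S i) ^ 2)) ≤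
      2 ^ m * ENNReal.ofReal (8 * Real.exp (m * (24576 * (r ^ 2) ^ 6 * s ^ 2))) := by
    have h := signSup_inner_le (fun i : Fin m => 2 * (s * f (S i) ^ 2)) (K := 2 * s)
      (fun i => by
        rw [Real.norm_eq_abs, abs_of_nonneg (by positivity)]
        have : f (S i) ^ 2 ≤ 1 := (sq_le_one_iff_abs_le_one _).2 (hf _)
        nlinarith)
      (T := fun (_ : κ) (i : Fin m) => 2 * (s * f (S i) ^ 2)) (fun k => ⟨1, by simp, by simp⟩)
    rw [Fintype.card_fin] at h
    refine h.trans (mul_le_mul_right (ENNReal.ofReal_le_ofReal ?_) _)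
    have : Real.exp (m * ((2 * s) ^ 2 / 2)) ≤
        Real.exp (m * (24576 * (r ^ 2) ^ 6 * s ^ 2)) := by
      refine Real.exp_le_exp.2 (mul_le_mul_of_nonneg_left ?_ m.cast_nonneg)
      have : 1 ≤ (r ^ 2) ^ 6 := one_le_pow₀ (one_le_pow₀ hr)
      nlinarith [sq_nonneg s]
    linarith [Real.exp_pos (m * (24576 * (r ^ 2) ^ 6 * s ^ 2))]
  rw [hsplit]
  refine (signSup_add_le _ _).trans ((mul_le_mul_right (add_le_add hA hB) _).trans (le_of_eq ?_))
  rw [← two_mul, ← mul_assoc, ENNReal.inv_mul_cancel (by simp) (by simp), one_mul]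

/-- The population loss as a Bochner integral. -/
def sqRisk {d : ℕ} (f g : X d → ℝ) : ℝ := ∫ x, (g x - f x) ^ 2 ∂(unifX d)

lemma abs_le_one_of_isTarget {d : ℕ} {f : X d → ℝ} (hf : IsTarget d f) (x : X d) : |f x| ≤ 1 :=
  abs_le.2 (hf.2 x)

lemma abs_sq_sub_le {a b K : ℝ} (ha : |a| ≤ K) (hb : |b| ≤ 1) : |(a - b) ^ 2| ≤ (K + 1) ^ 2 := by
  rw [abs_of_nonneg (sq_nonneg _), ← sq_abs (a - b)]
  exact pow_le_pow_left₀ (abs_nonneg _) ((abs_sub _ _).trans (add_le_add ha hb)) 2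

lemma popLoss_eq {d : ℕ} (hd : 2 ≤ d) {f : X d → ℝ} (hf : IsTarget d f) (g : C(X d, ℝ)) :
    popLoss (dataDist d f) g = ENNReal.ofReal (sqRisk f g) := by
  have := isProbabilityMeasure_unifX hd
  have hgm : Measurable g := g.continuous.measurable
  have hfm := hf.1
  rw [popLoss, dataDist, lintegral_map (by fun_prop) (by fun_prop), sqRisk,
    ofReal_integral_eq_lintegral_ofReal]
  · refine Integrable.of_bound (by fun_prop) ((‖g‖ + 1) ^ 2)
      (Filter.Eventually.of_forall fun x => ?_)
    exact abs_sq_sub_le (g.norm_coe_le_norm x) (abs_le_one_of_isTarget hf x)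
  · exact Filter.Eventually.of_forall fun x => sq_nonneg _

lemma continuous_sqRisk {d : ℕ} (hd : 2 ≤ d) {f : X d → ℝ} (hf : IsTarget d f) :
    Continuous fun g : C(X d, ℝ) => sqRisk f g := by
  have := isProbabilityMeasure_unifX hd
  have hfm := hf.1
  refine continuous_iff_continuousAt.2 fun g₀ => ?_
  refine continuousAt_of_dominated (bound := fun _ => (‖g₀‖ + 1 + 1) ^ 2)
    (Filter.Eventually.of_forall fun g => ?_) ?_ (integrable_const _)
    (Filter.Eventually.of_forall fun x => ?_)
  · have hgm : Measurable g := g.continuous.measurable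
    exact Measurable.aestronglyMeasurable (by fun_prop)
  · filter_upwards [continuous_norm.continuousAt.eventually (Iio_mem_nhds (lt_add_one ‖g₀‖))]
      with g hg
    refine Filter.Eventually.of_forall fun x => ?_
    exact abs_sq_sub_le ((g.norm_coe_le_norm x).trans (le_of_lt hg)) (abs_le_one_of_isTarget hf x)
  · exact (((continuous_eval_const x).sub continuous_const).pow 2).continuousAt

lemma continuous_sampleLoss {d m : ℕ} (S : Sample d m) :
    Continuous fun g : C(X d, ℝ) => sampleLoss S g := by
  unfold sampleLoss
  exact continuous_const.mul (continuous_finsetSum _ fun i _ =>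
    ((continuous_eval_const _).sub continuous_const).pow 2)

lemma measurable_sampleLoss {d m : ℕ} (g : C(X d, ℝ)) :
    Measurable fun S : Sample d m => sampleLoss S g := by
  have hgm : Measurable g := g.continuous.measurable
  unfold sampleLoss
  fun_prop

/-- A sample is obtained by labelling i.i.d. uniform points. -/
lemma measurePreserving_label {d : ℕ} (hd : 2 ≤ d) {f : X d → ℝ} (hf : IsTarget d f) (m : ℕ) :
    MeasurePreserving (fun (S : Fin m → X d) i => (S i, f (S i)))
      (Measure.pi fun _ => unifX d) (sampleDist d f m) := by
  have := isProbabilityMeasure_unifX hd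
  have hm : Measurable fun x => (x, f x) := measurable_id.prodMk hf.1
  have : IsProbabilityMeasure (dataDist d f) := Measure.isProbabilityMeasure_map hm.aemeasurable
  exact measurePreserving_pi _ _ fun _ => ⟨hm, rfl⟩

lemma isProbabilityMeasure_sampleDist {d : ℕ} (hd : 2 ≤ d) {f : X d → ℝ} (hf : IsTarget d f)
    (m : ℕ) : IsProbabilityMeasure (sampleDist d f m) := by
  have := isProbabilityMeasure_unifX hd
  rw [← (measurePreserving_label hd hf m).map_eq]
  exact Measure.isProbabilityMeasure_map (measurePreserving_label hd hf m).measurable.aemeasurable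

/-- Uniform convergence over the norm-bounded depth-3 networks of all widths. By separability of
`C(X d, ℝ)` the deviation is determined by countably many of them. -/
lemma measure_uniform_deviation_le {d m : ℕ} (hd : 2 ≤ d) (hm : 0 < m) {f : X d → ℝ}
    (hf : IsTarget d f) {M t : ℝ} (hM : 1 ≤ M) (ht : 0 < t) :
    sampleDist d f m {S | ∃ φ : Net (d + d) 3, φ.normSq ≤ M ∧
        t < |sqRisk f φ.realize - sampleLoss S φ.realize|} ≤
      ENNReal.ofReal (16 * Real.exp (-(m * (t ^ 2 / (393216 * M ^ 6))))) := by
  have := isProbabilityMeasure_unifX hd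
  have hm' : (0 : ℝ) < m := by exact_mod_cast hm
  set F : Set C(X d, ℝ) :=
    {g | ∃ φ : Net (d + d) 3, φ.normSq ≤ M ∧ φ.realize = g} with hF
  obtain ⟨G, hGF, hGc, hG⟩ :=
    (TopologicalSpace.IsSeparable.of_separableSpace F).exists_countable_dense_subset
  have : Countable G := hGc.to_subtype
  set E : Set (Sample d m) := {S | ∃ g : G, t < |sqRisk f g.1 - sampleLoss S g.1|} with hE
  have hEm : MeasurableSet E := by
    have : E = ⋃ g : G, {S | t < |sqRisk f g.1 - sampleLoss S g.1|} := by
      ext S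
      simp [hE]
    rw [this]
    refine MeasurableSet.iUnion fun g => measurableSet_lt measurable_const ?_
    exact measurable_norm.comp (measurable_const.sub (measurable_sampleLoss g.1))
  have hsub : {S | ∃ φ : Net (d + d) 3, φ.normSq ≤ M ∧
      t < |sqRisk f φ.realize - sampleLoss S φ.realize|} ⊆ E := by
    rintro S ⟨φ, hφ, hlt⟩
    have hmem : (⟨φ.realize, φ.continuous_realize⟩ : C(X d, ℝ)) ∈ closure G :=
      hG ⟨φ, hφ, rfl⟩
    have hopen : IsOpen {g : C(X d, ℝ) | t < |sqRisk f g - sampleLoss S g|} :=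
      isOpen_lt continuous_const ((continuous_sqRisk hd hf).sub (continuous_sampleLoss S)).abs
    obtain ⟨g, hg, hgG⟩ := mem_closure_iff.1 hmem _ hopen hlt
    exact ⟨⟨g, hgG⟩, hg⟩
  refine (measure_mono hsub).trans ?_
  rw [← (measurePreserving_label hd hf m).measure_preimage hEm.nullMeasurableSet]
  set ℓ : G → X d → ℝ := fun g x => (g.1 x - f x) ^ 2 with hℓ
  have hfm := hf.1
  have hℓm : ∀ g, Measurable (ℓ g) := fun g => by
    have hgm : Measurable g.1 := g.1.continuous.measurable
    fun_prop
  have hℓb : ∀ g, ∃ K, ∀ x, |ℓ g x| ≤ K := fun g =>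
    ⟨(‖g.1‖ + 1) ^ 2, fun x =>
      abs_sq_sub_le (g.1.norm_coe_le_norm x) (abs_le_one_of_isTarget hf x)⟩
  have hhull : ∀ g : G, (g.1 : X d → ℝ) ∈ hullThree d M := fun g => by
    obtain ⟨φ, hφ, h⟩ := hGF g.2
    exact h ▸ φ.realize_mem_hullThree hφ
  have hR : ∀ (S : Fin m → X d) (s : ℝ), 0 ≤ s → signSup (fun g i => s * ℓ g (S i)) ≤
      2 ^ Fintype.card (Fin m) *
        ENNReal.ofReal (8 * Real.exp (Fintype.card (Fin m) * (24576 * M ^ 6 * s ^ 2))) := by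
    intro S s hs
    rw [Fintype.card_fin]
    exact signSup_sqLoss_le hM (abs_le_one_of_isTarget hf) (fun g : G => g.1) hhull S hs
  have hR' : ∀ (S : Fin m → X d) (s : ℝ), 0 ≤ s → signSup (fun g i => s * -ℓ g (S i)) ≤
      2 ^ Fintype.card (Fin m) *
        ENNReal.ofReal (8 * Real.exp (Fintype.card (Fin m) * (24576 * M ^ 6 * s ^ 2))) := by
    intro S s hs
    simp only [mul_neg]
    rw [signSup_neg]
    exact hR S s hs
  have hQ : 0 < 24576 * M ^ 6 := by positivity
  have d1 := measure_deviation_le (ι := Fin m) (unifX d) hℓm hℓb hQ ht hR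
  have d2 := measure_deviation_le (ι := Fin m) (unifX d) (ℓ := fun g x => -ℓ g x)
    (fun g => (hℓm g).neg) (fun g => by simpa using hℓb g) hQ ht hR'
  rw [Fintype.card_fin, show 16 * (24576 * M ^ 6) = 393216 * M ^ 6 by ring] at d1 d2
  have hcover : (fun (S : Fin m → X d) i => (S i, f (S i))) ⁻¹' E ⊆
      {S | ∃ g, m * t < ∑ i, ((∫ x, ℓ g x ∂(unifX d)) - ℓ g (S i))} ∪
      {S | ∃ g, m * t < ∑ i, ((∫ x, -ℓ g x ∂(unifX d)) - -ℓ g (S i))} := by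
    rintro S ⟨g, hg⟩
    have e1 : ∑ i, ((∫ x, ℓ g x ∂(unifX d)) - ℓ g (S i)) =
        m * (sqRisk f g.1 - sampleLoss (fun i => (S i, f (S i))) g.1) := by
      rw [Finset.sum_sub_distrib, sampleLoss, sqRisk, mul_sub, ← mul_assoc,
        mul_one_div_cancel hm'.ne']
      simp [hℓ]
    have e2 : ∑ i, ((∫ x, -ℓ g x ∂(unifX d)) - -ℓ g (S i)) =
        -(m * (sqRisk f g.1 - sampleLoss (fun i => (S i, f (S i))) g.1)) := by
      rw [← e1, integral_neg, ← Finset.sum_neg_distrib]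
      exact Finset.sum_congr rfl fun i _ => by ring
    rcases lt_abs.1 hg with h | h
    · left
      exact ⟨g, by rw [e1]; exact mul_lt_mul_of_pos_left h hm'⟩
    · right
      exact ⟨g, by rw [e2, ← mul_neg]; exact mul_lt_mul_of_pos_left h hm'⟩
  refine (measure_mono hcover).trans ((measure_union_le _ _).trans ((add_le_add d1 d2).trans ?_))
  rw [← ENNReal.ofReal_add (by positivity) (by positivity)]
  refine ENNReal.ofReal_le_ofReal (le_of_eq ?_)
  ring

/-! ### A cheap good network from the ideal depth-2 rule -/

lemma repCost_le_of_mem_pareto {d L m : ℕ} {S : Sample d m} {g h : X d → ℝ}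
    (hg : g ∈ pareto d L S) (hh : h ∈ netFun d L) (hS : ∀ i, h (S i).1 = (S i).2) :
    repCost d L g ≤ repCost d L h := by
  by_contra! hlt
  refine hg.2 ⟨h, hh, ?_, hlt.le, Or.inr hlt⟩
  have h0 : sampleLoss S h = 0 := by simp [sampleLoss, hS]
  rw [h0]
  unfold sampleLoss
  positivity

/-- Lower integrals of functions that need not be measurable: a function that is at least `t` on a
measurable set of probability at least `1 / 2` has lower integral at least `t / 2`. -/
lemma exists_lt_of_lintegral_lt {Ω : Type*} [MeasurableSpace Ω] {P : Measure Ω}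
    {A : Set Ω} (hA : MeasurableSet A) (hP : 2⁻¹ ≤ P A) {F : Ω → ℝ≥0∞} {t : ℝ≥0∞}
    (h : ∫⁻ ω, F ω ∂P < t * 2⁻¹) : ∃ ω ∈ A, F ω < t := by
  by_contra! hc
  refine absurd h (not_lt.2 ?_)
  calc t * 2⁻¹ ≤ t * P A := by gcongr
    _ = ∫⁻ ω, A.indicator (fun _ => t) ω ∂P := by rw [lintegral_indicator_const hA]
    _ ≤ ∫⁻ ω, F ω ∂P := lintegral_mono fun ω => by
        by_cases hω : ω ∈ A
        · simpa [hω] using hc ω hω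
        · simp [hω]

/-- The samples with labels in `[-1, 1]` and with separated points. -/
def goodSamples (d n : ℕ) (η : ℝ) : Set (Sample d n) :=
  {S | (∀ i, |(S i).2| ≤ 1) ∧ ∀ i j, i ≠ j → η ≤ dist (S i).1.1 (S j).1.1}

lemma measurableSet_goodSamples (d n : ℕ) (η : ℝ) : MeasurableSet (goodSamples d n η) := by
  have : goodSamples d n η = (⋂ i, {S | |(S i).2| ≤ 1}) ∩
      ⋂ i, ⋂ j, ⋂ _ : i ≠ j, {S | η ≤ dist (S i).1.1 (S j).1.1} := by
    ext S
    simp [goodSamples]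
  rw [this]
  refine MeasurableSet.inter (MeasurableSet.iInter fun i => ?_) (MeasurableSet.iInter fun i =>
    MeasurableSet.iInter fun j => MeasurableSet.iInter fun _ => ?_)
  · have hm : Measurable fun S : Sample d n => (S i).2 := by fun_prop
    exact measurableSet_le (measurable_norm.comp hm) measurable_const
  · exact measurableSet_le measurable_const (by fun_prop)

lemma half_le_measure_goodSamples {d n : ℕ} (hd : 2 ≤ d) (hn : 1 ≤ n) {f : X d → ℝ}
    (hf : IsTarget d f) :
    2⁻¹ ≤ sampleDist d f n (goodSamples d n ((n : ℝ) ^ (-2 / ((d : ℝ) - 1)) / 8)) := by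
  have := isProbabilityMeasure_unifX hd
  set η := (n : ℝ) ^ (-2 / ((d : ℝ) - 1)) / 8
  rw [← (measurePreserving_label hd hf n).measure_preimage
    (measurableSet_goodSamples d n η).nullMeasurableSet]
  have hsub : {S : Fin n → X d | ∃ i j, i ≠ j ∧ dist (S i).1 (S j).1 < η}ᶜ ⊆
      (fun (S : Fin n → X d) i => (S i, f (S i))) ⁻¹' goodSamples d n η := by
    intro S hS
    simp only [mem_compl_iff, mem_ofPred_eq, not_exists, not_and, not_lt] at hS
    exact ⟨fun i => abs_le_one_of_isTarget hf _, hS⟩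
  refine le_trans ?_ (measure_mono hsub)
  rw [prob_compl_eq_one_sub (measurableSet_not_separated η)]
  refine ENNReal.le_sub_of_add_le_right (measure_ne_top _ _) ?_
  calc (2⁻¹ : ℝ≥0∞) + _ ≤ 2⁻¹ + 2⁻¹ := by gcongr; exact measure_not_separated_le hd hn
    _ = 1 := ENNReal.inv_two_add_inv_two

/-- On a separated sample every Pareto optimal function is at most as costly as an interpolant, so
that a good output of the ideal depth-2 rule is a cheap network of small population loss. -/
lemma exists_cheap_net {d n : ℕ} (hd : 2 ≤ d) (hn : 1 ≤ n) {f : X d → ℝ} (hf : IsTarget d f)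
    {ε : ℝ} (hε : 0 < ε)
    (h : ∫⁻ S, idealLoss d 2 (dataDist d f) S ∂(sampleDist d f n) ≤ ENNReal.ofReal ε) :
    ∃ φ : Net (d + d) 2, popLoss (dataDist d f) φ.realize ≤ ENNReal.ofReal (4 * ε) ∧
      φ.normSq ≤ 384 * (n : ℝ) ^ (((d : ℝ) + 3) / ((d : ℝ) - 1)) + 1 := by
  set η := (n : ℝ) ^ (-2 / ((d : ℝ) - 1)) / 8 with hη
  have hn' : (1 : ℝ) ≤ n := by exact_mod_cast hn
  have hd' : (2 : ℝ) ≤ d := by exact_mod_cast hd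
  have hη0 : 0 < η := by positivity
  have hη1 : η ≤ 1 := by
    have : (n : ℝ) ^ (-2 / ((d : ℝ) - 1)) ≤ 1 :=
      Real.rpow_le_one_of_one_le_of_nonpos hn'
        (div_nonpos_of_nonpos_of_nonneg (by norm_num) (by linarith))
    rw [hη]
    linarith
  have hlt : ∫⁻ S, idealLoss d 2 (dataDist d f) S ∂(sampleDist d f n) <
      ENNReal.ofReal (4 * ε) * 2⁻¹ := by
    refine h.trans_lt ?_
    rw [show (2 : ℝ≥0∞)⁻¹ = ENNReal.ofReal 2⁻¹ by
      rw [ENNReal.ofReal_inv_of_pos (by norm_num)]; simp,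
      ← ENNReal.ofReal_mul (by positivity)]
    exact (ENNReal.ofReal_lt_ofReal_iff (by positivity)).2 (by linarith)
  obtain ⟨S, hS, hSl⟩ := exists_lt_of_lintegral_lt (measurableSet_goodSamples d n η)
    (half_le_measure_goodSamples hd hn hf) hlt
  unfold idealLoss at hSl
  simp only [iInf_lt_iff] at hSl
  obtain ⟨g, hg, hgl⟩ := hSl
  obtain ⟨ψ, hψ, hψn⟩ := exists_interpolant (fun i => (S i).1) (fun i => (S i).2) hS.1 hη0 hη1 hS.2
  have e : 6 * (n : ℝ) / η ^ 2 = 384 * (n : ℝ) ^ (((d : ℝ) + 3) / ((d : ℝ) - 1)) := by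
    have e1 : ((d : ℝ) + 3) / ((d : ℝ) - 1) = 1 - (-2 / ((d : ℝ) - 1)) * 2 := by
      have : (d : ℝ) - 1 ≠ 0 := by linarith
      field_simp
      ring
    rw [e1, Real.rpow_sub (by linarith), Real.rpow_one, Real.rpow_mul (by linarith), hη,
      Real.rpow_ofNat]
    field_simp
    ring
  rw [e] at hψn
  have hcost : repCost d 2 g ≤
      ENNReal.ofReal (384 * (n : ℝ) ^ (((d : ℝ) + 3) / ((d : ℝ) - 1)) / (2 : ℕ)) := by
    refine (repCost_le_of_mem_pareto hg ⟨ψ, rfl⟩ hψ).trans ((repCost_realize_le ψ).trans ?_)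
    refine ENNReal.ofReal_le_ofReal ?_
    gcongr
  obtain ⟨φ, hφ, hφn⟩ := exists_net_of_repCost_le two_pos (by positivity) hcost
  exact ⟨φ, by rw [hφ]; exact hgl.le, hφn⟩

/-! ### The depth-3 threshold rule -/

/-- If a depth-3 network of moderate cost has population loss less than the threshold, then it is
admissible with high probability, so that all outputs of the threshold rule have moderate cost,
and uniform convergence applies to them. -/
lemma thresholdThreeSucceeds_of_net {d m : ℕ} (hd : 2 ≤ d) (hm : 0 < m) {f : X d → ℝ}
    (hf : IsTarget d f) {α θ ε δ M t : ℝ} (hα : 1 ≤ α) (ht : 0 < t) (hM : 0 ≤ M)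
    (ψ : Net (d + d) 3) (hψn : ψ.normSq ≤ M) (hψ : sqRisk f ψ.realize + t ≤ θ)
    (hε : α * θ + t ≤ ε)
    (hδ : 16 * Real.exp (-(m * (t ^ 2 / (393216 * (α * M + 1) ^ 6)))) ≤ δ) :
    ThresholdThreeSucceeds d f α θ ε δ m := by
  have hαM : 0 ≤ α * M := mul_nonneg (by linarith) hM
  refine le_trans (measure_mono ?_) ((measure_uniform_deviation_le hd hm hf
    (M := α * M + 1) (by linarith) ht).trans (ENNReal.ofReal_le_ofReal hδ))
  intro S hS
  by_contra hgood
  simp only [mem_ofPred_eq, not_exists, not_and, not_lt] at hgood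
  refine hS fun g hg => ?_
  have hψM : ψ.normSq ≤ α * M + 1 := by nlinarith
  have h1 : sampleLoss S ψ.realize ≤ θ := by
    have := (abs_le.1 (hgood ψ hψM)).1
    linarith
  have h2 : repCost d 3 g ≤ ENNReal.ofReal (α * M / (3 : ℕ)) := by
    refine hg.2.2.trans ?_
    rw [mul_div_assoc, ENNReal.ofReal_mul (by linarith)]
    refine mul_le_mul_right ((iInf₂_le ψ.realize ⟨⟨ψ, rfl⟩, h1⟩).trans
      ((repCost_realize_le ψ).trans (ENNReal.ofReal_le_ofReal ?_))) _
    gcongr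
  obtain ⟨φ, rfl, hφn⟩ := exists_net_of_repCost_le three_pos hαM h2
  have h3 := (abs_le.1 (hgood φ hφn)).2
  have h4 := popLoss_eq hd hf ⟨φ.realize, φ.continuous_realize⟩
  simp only [ContinuousMap.coe_mk] at h4
  rw [h4]
  exact ENNReal.ofReal_le_ofReal (by linarith [hg.2.1])

lemma thresholdThreeSucceeds_of_one_le {d : ℕ} (hd : 2 ≤ d) {f : X d → ℝ} (hf : IsTarget d f)
    {α θ ε δ : ℝ} (hδ : 1 ≤ δ) (m : ℕ) : ThresholdThreeSucceeds d f α θ ε δ m := by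
  have := isProbabilityMeasure_sampleDist hd hf m
  exact prob_le_one.trans (ENNReal.one_le_ofReal.2 hδ)

/-- The confidence term: for `δ < 1` the constant prefactor `16` is absorbed by `log (2 / δ)`. -/
lemma sixteen_mul_exp_neg_le {δ q : ℝ} (hδ0 : 0 < δ) (hδ1 : δ < 1)
    (hq : 4 * Real.log (2 / δ) ≤ q) : 16 * Real.exp (-q) ≤ δ := by
  have h1 : Real.exp (-q) ≤ Real.exp (-(4 * Real.log (2 / δ))) := Real.exp_le_exp.2 (by linarith)
  have h2 : Real.exp (-(4 * Real.log (2 / δ))) = (δ / 2) ^ 4 := by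
    rw [← mul_neg, ← Real.log_inv, inv_div, mul_comm, Real.exp_mul, Real.exp_log (by positivity)]
    norm_cast
  rw [h2] at h1
  have h3 : δ ^ 4 ≤ δ := pow_le_of_le_one hδ0.le hδ1.le (by norm_num)
  linarith [h3, h1, show (δ / 2) ^ 4 = δ ^ 4 / 16 by ring]

lemma exists_sample_complexity {α c : ℝ} (hα : 1 ≤ α) (hc : 0 < c) (hαc : α * c < 1) :
    ∃ C : ℝ, 0 < C ∧
      ∀ (d : ℕ) (f : X d → ℝ) (m₂ : ℝ → ℕ), 2 ≤ d → IsTarget d f → IdealTwoLearns d f m₂ →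
        ∀ ε δ : ℝ, 0 < ε → 0 < δ → ∀ m : ℕ,
          C * ε⁻¹ ^ 2 *
              ((d : ℝ) + (m₂ (c * ε / 16) : ℝ) ^ (((d : ℝ) + 3) / ((d : ℝ) - 1))) ^ 6 *
              Real.log (2 / δ) ≤ (m : ℝ) →
            ThresholdThreeSucceeds d f α (c * ε) ε δ m := by
  set κ : ℝ := min (c / 2) (1 - α * c) with hκ
  have hκ0 : 0 < κ := lt_min (by positivity) (by linarith)
  refine ⟨4 * 393216 * (770 * α) ^ 6 / κ ^ 2, by positivity, ?_⟩
  intro d f m₂ hd hf hideal ε δ hε hδ m hm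
  rcases le_or_gt 1 δ with hδ1 | hδ1
  · exact thresholdThreeSucceeds_of_one_le hd hf hδ1 m
  have hd' : (2 : ℝ) ≤ d := by exact_mod_cast hd
  set p : ℝ := ((d : ℝ) + 3) / ((d : ℝ) - 1) with hp
  have hp0 : 0 < p := div_pos (by linarith) (by linarith)
  set k := m₂ (c * ε / 16) with hk
  set B : ℝ := (d : ℝ) + (k : ℝ) ^ p with hB
  have hkp : 0 ≤ (k : ℝ) ^ p := by positivity
  have hB2 : 2 ≤ B := by linarith
  have hlog : 0 < Real.log (2 / δ) := Real.log_pos (by rw [lt_div_iff₀ hδ]; linarith)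
  have hm0 : 0 < m := by
    have : (0 : ℝ) < m := lt_of_lt_of_le (by positivity) hm
    exact_mod_cast this
  -- Sample size zero is excluded so that negative powers of `n` make sense.
  set n := max k 1 with hn
  have hnp : (n : ℝ) ^ p ≤ 1 + (k : ℝ) ^ p := by
    rcases le_total k 1 with h | h
    · rw [hn, max_eq_right h]
      simpa using hkp
    · rw [hn, max_eq_left h]
      linarith
  obtain ⟨φ, hφl, hφn⟩ := exists_cheap_net hd (le_max_right k 1) hf (by positivity)
    (hideal (c * ε / 16) (by positivity) n (le_max_left k 1))
  obtain ⟨ψ, hψe, hψn⟩ := φ.exists_depth_three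
  have hr : ψ.realize = φ.realize := by
    funext x
    simp only [Net.realize, hψe]
  have hM : ψ.normSq ≤ 4 * d + 772 + 768 * (k : ℝ) ^ p := by
    push_cast at hψn
    linarith
  have hrisk : sqRisk f ψ.realize ≤ c * ε / 4 := by
    have h4 := popLoss_eq hd hf ⟨ψ.realize, ψ.continuous_realize⟩
    simp only [ContinuousMap.coe_mk] at h4
    rw [← hr, h4, ENNReal.ofReal_le_ofReal_iff (by positivity)] at hφl
    linarith
  have hκ1 : κ * ε ≤ c / 2 * ε := mul_le_mul_of_nonneg_right (min_le_left _ _) hε.le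
  have hκ2 : κ * ε ≤ (1 - α * c) * ε := mul_le_mul_of_nonneg_right (min_le_right _ _) hε.le
  have hcε : 0 < c * ε := by positivity
  refine thresholdThreeSucceeds_of_net hd hm0 hf hα (t := κ * ε) (by positivity)
    (by positivity) ψ hM (by linarith) (by linarith) ?_
  refine sixteen_mul_exp_neg_le hδ hδ1 ?_
  have hMB : α * (4 * d + 772 + 768 * (k : ℝ) ^ p) + 1 ≤ 770 * α * B := by
    have : 4 * (d : ℝ) + 773 + 768 * (k : ℝ) ^ p ≤ 770 * B := by
      rw [hB]
      linarith
    nlinarith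
  have hpow : (α * (4 * d + 772 + 768 * (k : ℝ) ^ p) + 1) ^ 6 ≤ (770 * α * B) ^ 6 :=
    pow_le_pow_left₀ (by positivity) hMB 6
  calc 4 * Real.log (2 / δ)
      = (4 * 393216 * (770 * α) ^ 6 / κ ^ 2 * ε⁻¹ ^ 2 * B ^ 6 * Real.log (2 / δ)) *
          ((κ * ε) ^ 2 / (393216 * (770 * α * B) ^ 6)) := by
        field_simp
    _ ≤ m * ((κ * ε) ^ 2 / (393216 * (770 * α * B) ^ 6)) :=
        mul_le_mul_of_nonneg_right hm (by positivity)
    _ ≤ m * ((κ * ε) ^ 2 / (393216 * (α * (4 * d + 772 + 768 * (k : ℝ) ^ p) + 1) ^ 6)) := by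
        gcongr

/-! ### Polynomial growth -/

/-- The exponent `(d + 3) / (d - 1)` is at most `5`, so that polynomial bounds are preserved. -/
lemma add_rpow_le_of_poly {d n k : ℕ} (hd : 2 ≤ d) {A D : ℝ} (hA : 0 ≤ A) (hdD : (d : ℝ) ≤ D)
    (hn : (n : ℝ) ≤ A * D ^ k) :
    (d : ℝ) + (n : ℝ) ^ (((d : ℝ) + 3) / ((d : ℝ) - 1)) ≤ (1 + A ^ 5) * D ^ (5 * k + 1) := by
  have hd' : (2 : ℝ) ≤ d := by exact_mod_cast hd
  have hD : 1 ≤ D := by linarith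
  have hp : ((d : ℝ) + 3) / ((d : ℝ) - 1) ≤ 5 := by
    rw [div_le_iff₀ (by linarith)]
    linarith
  have hp0 : 0 < ((d : ℝ) + 3) / ((d : ℝ) - 1) := div_pos (by linarith) (by linarith)
  have h1 : (n : ℝ) ^ (((d : ℝ) + 3) / ((d : ℝ) - 1)) ≤ (n : ℝ) ^ 5 := by
    rcases Nat.eq_zero_or_pos n with rfl | h
    · simp [hp0.ne']
    · have : (1 : ℝ) ≤ n := by exact_mod_cast h
      calc (n : ℝ) ^ (((d : ℝ) + 3) / ((d : ℝ) - 1)) ≤ (n : ℝ) ^ (5 : ℝ) :=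
            Real.rpow_le_rpow_of_exponent_le this hp
        _ = (n : ℝ) ^ 5 := by norm_cast
  have h2 : (n : ℝ) ^ 5 ≤ A ^ 5 * D ^ (5 * k + 1) := by
    calc (n : ℝ) ^ 5 ≤ (A * D ^ k) ^ 5 := pow_le_pow_left₀ n.cast_nonneg hn 5
      _ = A ^ 5 * D ^ (5 * k) := by rw [mul_pow, ← pow_mul, mul_comm k]
      _ ≤ A ^ 5 * D ^ (5 * k + 1) :=
          mul_le_mul_of_nonneg_left (pow_le_pow_right₀ hD (by omega)) (by positivity)
  have h3 : (d : ℝ) ≤ D ^ (5 * k + 1) := hdD.trans (le_self_pow₀ hD (by omega))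
  linarith

end
end DepthSep

open DepthSep in
theorem theorem5p2 (α c : ℝ) (hα : 1 ≤ α) (hc : 0 < c) (hαc : α * c < 1) :
    -- the explicit sample complexity; `C` depends only on `α` and `c`
    (∃ C : ℝ, 0 < C ∧
      ∀ (d : ℕ) (f : X d → ℝ) (m₂ : ℝ → ℕ), 2 ≤ d → IsTarget d f → IdealTwoLearns d f m₂ →
        ∀ ε δ : ℝ, 0 < ε → 0 < δ → ∀ m : ℕ,
          C * ε⁻¹ ^ 2 *
              ((d : ℝ) + (m₂ (c * ε / 16) : ℝ) ^ (((d : ℝ) + 3) / ((d : ℝ) - 1))) ^ 6 *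
              Real.log (2 / δ) ≤ (m : ℝ) →
            ThresholdThreeSucceeds d f α (c * ε) ε δ m) ∧
    -- families of distributions: polynomial growth is inherited
    (∀ (f : ∀ d : ℕ, X d → ℝ) (m₂ : ℕ → ℝ → ℕ),
      (∀ d : ℕ, 2 ≤ d → IsTarget d (f d) ∧ IdealTwoLearns d (f d) (m₂ d)) →
        -- polynomial growth in `d` for each fixed accuracy
        ((∀ ε : ℝ, 0 < ε → ∃ (A : ℝ) (k : ℕ), ∀ d : ℕ, 2 ≤ d → (m₂ d ε : ℝ) ≤ A * (d : ℝ) ^ k) →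
          ∀ ε : ℝ, 0 < ε → ∃ (A : ℝ) (k : ℕ), ∀ d : ℕ, 2 ≤ d → ∀ δ : ℝ, 0 < δ → ∀ m : ℕ,
            A * (d : ℝ) ^ k * Real.log (2 / δ) ≤ (m : ℝ) →
              ThresholdThreeSucceeds d (f d) α (c * ε) ε δ m) ∧
        -- polynomial growth in `d` and `1 / ε` jointly
        ((∃ (A : ℝ) (k : ℕ), ∀ d : ℕ, 2 ≤ d → ∀ ε : ℝ, 0 < ε →
            (m₂ d ε : ℝ) ≤ A * ((d : ℝ) + 1 / ε) ^ k) →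
          ∃ (A : ℝ) (k : ℕ), ∀ d : ℕ, 2 ≤ d → ∀ ε δ : ℝ, 0 < ε → 0 < δ → ∀ m : ℕ,
            A * ((d : ℝ) + 1 / ε) ^ k * Real.log (2 / δ) ≤ (m : ℝ) →
              ThresholdThreeSucceeds d (f d) α (c * ε) ε δ m)) := by
  obtain ⟨C, hC, hmain⟩ := exists_sample_complexity hα hc hαc
  refine ⟨⟨C, hC, hmain⟩, fun f m₂ hfam => ⟨fun hpoly ε hε => ?_, ?_⟩⟩
  · obtain ⟨A, k, hA⟩ := hpoly (c * ε / 16) (by positivity)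
    refine ⟨C * ε⁻¹ ^ 2 * (1 + |A| ^ 5) ^ 6, (5 * k + 1) * 6, fun d hd δ hδ m hm => ?_⟩
    obtain ⟨hf, hideal⟩ := hfam d hd
    rcases le_or_gt 1 δ with hδ1 | hδ1
    · exact thresholdThreeSucceeds_of_one_le hd hf hδ1 m
    have hlog : 0 ≤ Real.log (2 / δ) := Real.log_nonneg (by rw [le_div_iff₀ hδ]; linarith)
    refine hmain d (f d) (m₂ d) hd hf hideal ε δ hε hδ m (le_trans ?_ hm)
    refine mul_le_mul_of_nonneg_right ?_ hlog
    have hB := add_rpow_le_of_poly hd (abs_nonneg A) (le_refl (d : ℝ))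
      ((hA d hd).trans (mul_le_mul_of_nonneg_right (le_abs_self A) (by positivity)))
    rw [mul_assoc _ _ ((d : ℝ) ^ _), pow_mul, ← mul_pow]
    gcongr
  · rintro ⟨A, k, hA⟩
    set A₂ : ℝ := |A| * (1 + 16 / c) ^ k with hA₂
    refine ⟨C * (1 + A₂ ^ 5) ^ 6, 2 + (5 * k + 1) * 6, fun d hd ε δ hε hδ m hm => ?_⟩
    obtain ⟨hf, hideal⟩ := hfam d hd
    rcases le_or_gt 1 δ with hδ1 | hδ1
    · exact thresholdThreeSucceeds_of_one_le hd hf hδ1 m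
    have hlog : 0 ≤ Real.log (2 / δ) := Real.log_nonneg (by rw [le_div_iff₀ hδ]; linarith)
    refine hmain d (f d) (m₂ d) hd hf hideal ε δ hε hδ m (le_trans ?_ hm)
    refine mul_le_mul_of_nonneg_right ?_ hlog
    set D : ℝ := (d : ℝ) + 1 / ε with hD
    have hεi : 0 < 1 / ε := by positivity
    have hdD : (d : ℝ) ≤ D := by linarith
    have hn : (m₂ d (c * ε / 16) : ℝ) ≤ A₂ * D ^ k := by
      refine (hA d hd _ (by positivity)).trans ?_
      have h1 : (d : ℝ) + 1 / (c * ε / 16) ≤ (1 + 16 / c) * D := by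
        have e : (1 + 16 / c) * D = d + 1 / (c * ε / 16) + (1 / ε + 16 / c * d) := by
          rw [hD]
          field_simp
          ring
        rw [e]
        have : 0 ≤ 1 / ε + 16 / c * d := by positivity
        linarith
      rw [hA₂, mul_assoc, ← mul_pow]
      exact mul_le_mul (le_abs_self A) (pow_le_pow_left₀ (by positivity) h1 k) (by positivity)
        (abs_nonneg A)
    have hB := add_rpow_le_of_poly hd (by positivity) hdD hn
    have hεD : ε⁻¹ ≤ D := by
      rw [hD, one_div]
      linarith [(Nat.cast_nonneg d : (0 : ℝ) ≤ d)]
    calc C * ε⁻¹ ^ 2 * ((d : ℝ) + (m₂ d (c * ε / 16) : ℝ) ^ (((d : ℝ) + 3) / ((d : ℝ) - 1))) ^ 6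
        ≤ C * D ^ 2 * ((1 + A₂ ^ 5) * D ^ (5 * k + 1)) ^ 6 := by gcongr
      _ = C * (1 + A₂ ^ 5) ^ 6 * D ^ (2 + (5 * k + 1) * 6) := by
          rw [mul_pow, ← pow_mul, pow_add]
          ring
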